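/- **Theorem.** Let $\mathbf X$ be a category. Consider the following structures on $\mathbf X$ (composition is written $gf$ for "$f$ then $g$"). (i) *Restriction category with restriction products*: an operation $f\mapsto\overline f$ assigning to $f:A\to B$ a map $\overline f:A\to A$ with $f\overline f=f$, $\overline f\,\overline g=\overline g\,\overline f$, $\overline{g\overline f}=\overline g\,\overline f$ (for $f,g$ with the same domain) and $\overline g f=f\,\overline{gf}$ (for composable $f,g$); call $f$ *total* if $\overline f=1$. Further, a functor $\times:\mathbf X\times\mathbf X\to\mathbf X$ with $\overline{f\times g}=\overline f\times\overline g$, and total maps $\Delta:A\to A\times A$, $p:A\times B\to A$, $q:A\times B\to B$ with $p\Delta=1$, $q\Delta=1$, $(p\times q)\Delta=1$, $p(f\times g)=f\,p\,(\overline f\times\overline g)$, $q(f\times g)=g\,q\,(\overline f\times\overline g)$, $\Delta f=(f\times f)\Delta\overline f$; and an object $T$ with total maps $t_A:A\to T$ such that $t_T=1$ and $t_Bf=t_A\overline f$ for $f:A\to B$. (ii) *p-category with a one-element object*: a functor $\times:\mathbf X\times\mathbf X\to\mathbf X$, a natural family $\Delta:A\to A\times A$, families $p_{A,B}:A\times B\to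 A$ natural in $A$ and $q_{A,B}:A\times B\to B$ natural in $B$, with $p\Delta=1$, $q\Delta=1$, $(p\times q)\Delta=1$, $p(1\times p)=p=p(1\times q)$, $q(p\times 1)=q=q(q\times 1)$, and such that $\alpha=(1\times q)((1\times p)\times q)\Delta:A\times(B\times C)\to(A\times B)\times C$ and $\tau=(q\times p)\Delta:A\times B\to B\times A$ are natural in all variables; and an object $T$ with maps $t_A:A\to T$ such that each $p:A\times T\to A$ is invertible with inverse $(1\times t_A)\Delta$. (iii) *Partial cartesian category* (Curien–Obtulowicz), presented equationally: for objects $A,B$ an object $A\times B$ with maps $p:A\times B\to A$ and $q:A\times B\to B$; for $f:C\to A$ and $g:C\to B$ a map $\langle f,g\rangle:C\to A\times B$; and an object $T$ with maps $t_A:A\to T$; such that, writing $f{\restriction}g=p\langle f,g\rangle$, one has $\langle f,g\rangle h=\langle fh,gh\rangle$, $\langle p,q\rangle=1$, $q\langle f,g\rangle=g{\restriction}f$, $f{\restriction}f=f$, $(f{\restriction}g){\restriction}h=(f{\restriction}h){\restriction}g$, $f{\restriction}(g{\restriction}h)=(f{\restriction}g){\restriction}h$, $k(f{\restriction}g)=(kf){\restriction}g$,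 $f{\restriction}p=f$, $f{\restriction}q=f$, $f{\restriction}t_A=f$, and $f=t_A{\restriction}f$ for every $f:A\to T$. (iv) *Counital copy category*: a symmetric monoidal structure $(\otimes,I)$ on $\mathbf X$ with a monoidal natural transformation $\Delta:A\to A\otimes A$ that is coassociative and cocommutative and has counits $\varepsilon_A:A\to I$. (v) A symmetric monoidal structure on $\mathbf X$ for which the forgetful functor $U:\mathsf{Copy}(\mathbf X)\to\mathbf X$ is an equivalence. Here, for a symmetric monoidal category $\mathcal V$, $\mathsf{Copy}(\mathcal V)$ is the symmetric monoidal category whose objects are the cocommutative comonoids in $\mathcal V$, whose morphisms are the maps that preserve the comultiplication (but not necessarily the counit), and whose tensor product is the usual tensor product of comonoids. (vi) A symmetric monoidal structure on $\mathbf X$ for which there are a symmetric monoidal category $\mathcal V$ and an equivalence of symmetric monoidal categories $\mathbf X\simeq\mathsf{Copy}(\mathcal V)$. These structures are equivalent: there are bijections between the collections of structures (i)–(vi) on $\mathbf X$ which are compatible with the data as follows. * Between (i) and (ii) they keep $\times,\Delta,p,q,T,t$, and $\overline f=p(1\times f)\Delta$. * Between (i) and (iii) they keep $p,q,T,t$ and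 the objects $A\times B$, with $f\times g=\langle fp,gq\rangle$ and $\Delta=\langle1,1\rangle$. * Between (i) and (iv), $\times$ is $\otimes$, $T=I$, $t=\varepsilon$, $\Delta$ is the same, and $p,q$ are the composites $A\otimes B\to A\otimes I\cong A$ and $A\otimes B\to I\otimes B\cong B$ induced by the counits; the associativity of the monoidal structure is the $\alpha$ of (ii), the symmetry is $\tau$, and the unit isomorphisms are the projections. * Between (iv), (v) and (vi) they keep the symmetric monoidal structure. In (vi), $\mathcal V$ can be taken of the same size as $\mathbf X$, and a $\mathcal V$ of any size already gives (v). Moreover all the structure is determined by the symmetric monoidal structure, and also by the restriction structure: two structures (i) with the same associated symmetric monoidal structure are equal, and two structures (i) with the same restriction $f\mapsto\overline f$ are related by a unique isomorphism over the identity of $\mathbf X$ (isomorphisms $A\times B\cong A\times'B$, $T\cong T'$ compatible with $f\times g$, $\Delta$, $p$, $q$, $t$), and this isomorphism makes the identity functor a symmetric monoidal functor between the associated symmetric monoidal structures. -/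

import Mathlib

open CategoryTheory MonoidalCategory

universe u v u' v'

namespace PartialMaps

/-! ### Restriction categories -/

/-- A restriction structure on a category: an assignment `f ↦ rst f` with the four axioms
`R.1`–`R.4` (written in diagrammatic order). -/
structure RestrictionStructure (C : Type u) [Category.{v} C] where
  rst : ∀ {X Y : C}, (X ⟶ Y) → (X ⟶ X)
  rst_comp_self : ∀ {X Y : C} (f : X ⟶ Y), rst f ≫ f = f
  rst_comm : ∀ {X Y Z : C} (f : X ⟶ Y) (g : X ⟶ Z), rst f ≫ rst g = rst g ≫ rst f
  rst_rst_comp : ∀ {X Y Z : C} (f : X ⟶ Y) (g : X ⟶ Z), rst (rst f ≫ g) = rst f ≫ rst g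
  comp_rst : ∀ {X Y Z : C} (f : X ⟶ Y) (g : Y ⟶ Z), f ≫ rst g = rst (f ≫ g) ≫ f

/-- A map is total when its restriction is the identity. -/
def RestrictionStructure.IsTotal {C : Type u} [Category.{v} C] (R : RestrictionStructure C)
    {X Y : C} (f : X ⟶ Y) : Prop :=
  R.rst f = 𝟙 X

/-! ### Raw data common to restriction products and p-categories -/

/-- The raw data (no axioms) of a binary product-like operation on objects and arrows,
with diagonals and projections. -/
structure BinaryData (C : Type u) [Category.{v} C] where
  prod : C → C → C
  map : ∀ {X X' Y Y' : C}, (X ⟶ X') → (Y ⟶ Y') → (prod X Y ⟶ prod X' Y')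
  diag : ∀ X : C, X ⟶ prod X X
  fst : ∀ X Y : C, prod X Y ⟶ X
  snd : ∀ X Y : C, prod X Y ⟶ Y

/-- Binary data together with an object `one` and a map `bang X : X ⟶ one` for each `X`
(no axioms). -/
structure CartesianData (C : Type u) [Category.{v} C] extends BinaryData C where
  one : C
  bang : ∀ X : C, X ⟶ one

namespace BinaryData

variable {C : Type u} [Category.{v} C] (D : BinaryData C)

/-- `X × (Y × Z) ⟶ (X × Y) × Z`: the composite of `Δ`, `(1 × p) × q` and `1 × q`. -/
def assoc (X Y Z : C) : D.prod X (D.prod Y Z) ⟶ D.prod (D.prod X Y) Z :=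
  D.diag (D.prod X (D.prod Y Z)) ≫
    D.map (D.map (𝟙 X) (D.fst Y Z)) (D.snd X (D.prod Y Z)) ≫
      D.map (𝟙 (D.prod X Y)) (D.snd Y Z)

/-- `X × Y ⟶ Y × X`: the composite of `Δ` and `q × p`. -/
def swap (X Y : C) : D.prod X Y ⟶ D.prod Y X :=
  D.diag (D.prod X Y) ≫ D.map (D.snd X Y) (D.fst X Y)

/-- `dom f = p (1 × f) Δ`. -/
def dom {X Y : C} (f : X ⟶ Y) : X ⟶ X :=
  D.diag X ≫ D.map (𝟙 X) f ≫ D.fst X Y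

/-- The operation `prod`, `map` is a functor `C × C ⥤ C`. -/
structure IsFunctorial : Prop where
  map_id : ∀ X Y : C, D.map (𝟙 X) (𝟙 Y) = 𝟙 (D.prod X Y)
  map_comp : ∀ {X X' X'' Y Y' Y'' : C} (f : X ⟶ X') (f' : X' ⟶ X'') (g : Y ⟶ Y') (g' : Y' ⟶ Y''),
    D.map (f ≫ f') (g ≫ g') = D.map f g ≫ D.map f' g'

/-- The data are binary restriction products for the restriction structure `R`: a restriction
functor `C × C ⥤ C` that is right adjoint to the diagonal in the 2-category of restriction
categories, restriction functors, and lax natural transformations with total components,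
with unit `Δ` and counit `(p, q)`. -/
structure IsRestrictionProduct (R : RestrictionStructure C) : Prop extends D.IsFunctorial where
  rst_map : ∀ {X X' Y Y' : C} (f : X ⟶ X') (g : Y ⟶ Y'),
    R.rst (D.map f g) = D.map (R.rst f) (R.rst g)
  diag_total : ∀ X : C, R.IsTotal (D.diag X)
  fst_total : ∀ X Y : C, R.IsTotal (D.fst X Y)
  snd_total : ∀ X Y : C, R.IsTotal (D.snd X Y)
  diag_fst : ∀ X : C, D.diag X ≫ D.fst X X = 𝟙 X
  diag_snd : ∀ X : C, D.diag X ≫ D.snd X X = 𝟙 X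
  diag_map_fst_snd : ∀ X Y : C, D.diag (D.prod X Y) ≫ D.map (D.fst X Y) (D.snd X Y) = 𝟙 _
  fst_lax : ∀ {X X' Y Y' : C} (f : X ⟶ X') (g : Y ⟶ Y'),
    D.map f g ≫ D.fst X' Y' = D.map (R.rst f) (R.rst g) ≫ D.fst X Y ≫ f
  snd_lax : ∀ {X X' Y Y' : C} (f : X ⟶ X') (g : Y ⟶ Y'),
    D.map f g ≫ D.snd X' Y' = D.map (R.rst f) (R.rst g) ≫ D.snd X Y ≫ g
  diag_lax : ∀ {X X' : C} (f : X ⟶ X'),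
    f ≫ D.diag X' = R.rst f ≫ D.diag X ≫ D.map f f

/-- The axioms of a p-category. -/
structure IsPCategory : Prop extends D.IsFunctorial where
  diag_natural : ∀ {X X' : C} (f : X ⟶ X'), f ≫ D.diag X' = D.diag X ≫ D.map f f
  fst_natural : ∀ {X X' : C} (Y : C) (f : X ⟶ X'),
    D.map f (𝟙 Y) ≫ D.fst X' Y = D.fst X Y ≫ f
  snd_natural : ∀ (X : C) {Y Y' : C} (g : Y ⟶ Y'),
    D.map (𝟙 X) g ≫ D.snd X Y' = D.snd X Y ≫ g
  diag_fst : ∀ X : C, D.diag X ≫ D.fst X X = 𝟙 X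
  diag_snd : ∀ X : C, D.diag X ≫ D.snd X X = 𝟙 X
  diag_map_fst_snd : ∀ X Y : C, D.diag (D.prod X Y) ≫ D.map (D.fst X Y) (D.snd X Y) = 𝟙 _
  map_fst_fst : ∀ X Y Z : C, D.map (𝟙 X) (D.fst Y Z) ≫ D.fst X Y = D.fst X (D.prod Y Z)
  map_snd_fst : ∀ X Y Z : C, D.map (𝟙 X) (D.snd Y Z) ≫ D.fst X Z = D.fst X (D.prod Y Z)
  map_fst_snd : ∀ X Y Z : C, D.map (D.fst X Y) (𝟙 Z) ≫ D.snd X Z = D.snd (D.prod X Y) Z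
  map_snd_snd : ∀ X Y Z : C, D.map (D.snd X Y) (𝟙 Z) ≫ D.snd Y Z = D.snd (D.prod X Y) Z
  assoc_natural : ∀ {X X' Y Y' Z Z' : C} (f : X ⟶ X') (g : Y ⟶ Y') (h : Z ⟶ Z'),
    D.map f (D.map g h) ≫ D.assoc X' Y' Z' = D.assoc X Y Z ≫ D.map (D.map f g) h
  swap_natural : ∀ {X X' Y Y' : C} (f : X ⟶ X') (g : Y ⟶ Y'),
    D.map f g ≫ D.swap X' Y' = D.swap X Y ≫ D.map g f

end BinaryData

namespace CartesianData

variable {C : Type u} [Category.{v} C] (D : CartesianData C)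

/-- `one`, `bang` is a restriction terminal object for the restriction structure `R`. -/
structure IsRestrictionTerminal (R : RestrictionStructure C) : Prop where
  bang_total : ∀ X : C, R.IsTotal (D.bang X)
  bang_one : D.bang D.one = 𝟙 D.one
  comp_bang : ∀ {X Y : C} (f : X ⟶ Y), f ≫ D.bang Y = R.rst f ≫ D.bang X

/-- `one`, `bang` is a one-element object: each `p : X × one ⟶ X` is invertible, with inverse
the composite of `Δ` and `1 × bang X`. -/
structure IsOneElement : Prop where
  fst_inv : ∀ X : C, D.fst X D.one ≫ D.diag X ≫ D.map (𝟙 X) (D.bang X) = 𝟙 (D.prod X D.one)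
  inv_fst : ∀ X : C, (D.diag X ≫ D.map (𝟙 X) (D.bang X)) ≫ D.fst X D.one = 𝟙 X

/-- An isomorphism (identity on the underlying category) between two sets of data. -/
@[ext]
structure Iso (D E : CartesianData C) where
  prodIso : ∀ X Y : C, D.prod X Y ≅ E.prod X Y
  oneIso : D.one ≅ E.one
  map_comp : ∀ {X X' Y Y' : C} (f : X ⟶ X') (g : Y ⟶ Y'),
    D.map f g ≫ (prodIso X' Y').hom = (prodIso X Y).hom ≫ E.map f g
  diag_comp : ∀ X : C, D.diag X ≫ (prodIso X X).hom = E.diag X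
  comp_fst : ∀ X Y : C, (prodIso X Y).hom ≫ E.fst X Y = D.fst X Y
  comp_snd : ∀ X Y : C, (prodIso X Y).hom ≫ E.snd X Y = D.snd X Y
  bang_comp : ∀ X : C, D.bang X ≫ oneIso.hom = E.bang X

end CartesianData

/-- Restriction category with (chosen) restriction products: a restriction structure, binary
restriction products, and a restriction terminal object. -/
structure RestrictionProductCategory (C : Type u) [Category.{v} C] where
  restriction : RestrictionStructure C
  data : CartesianData C
  isProduct : data.toBinaryData.IsRestrictionProduct restriction
  isTerminal : data.IsRestrictionTerminal restriction

/-- p-category with a one-element object. -/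
structure PCategoryWithOne (C : Type u) [Category.{v} C] where
  data : CartesianData C
  isPCategory : data.toBinaryData.IsPCategory
  isOneElement : data.IsOneElement

/-! ### Partial cartesian categories -/

/-- The raw data of a partial cartesian category: partial products presented by projections and
a pairing operation on all arrows, and a partial terminal object. -/
structure PairingData (C : Type u) [Category.{v} C] where
  prod : C → C → C
  fst : ∀ X Y : C, prod X Y ⟶ X
  snd : ∀ X Y : C, prod X Y ⟶ Y
  pair : ∀ {W X Y : C}, (W ⟶ X) → (W ⟶ Y) → (W ⟶ prod X Y)
  one : C
  bang : ∀ X : C, X ⟶ one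

namespace PairingData

variable {C : Type u} [Category.{v} C] (D : PairingData C)

/-- `f ↾ g`, the arrow `f` restricted to the domain of definition of `g`, is `fst ∘ ⟨f, g⟩`. -/
def restrict {W X Y : C} (f : W ⟶ X) (g : W ⟶ Y) : W ⟶ X :=
  D.pair f g ≫ D.fst X Y

/-- Product of arrows, diagonals, and projections obtained from pairing. -/
def toCartesianData : CartesianData C where
  prod := D.prod
  map {X _ Y _} f g := D.pair (D.fst X Y ≫ f) (D.snd X Y ≫ g)
  diag X := D.pair (𝟙 X) (𝟙 X)
  fst := D.fst
  snd := D.snd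
  one := D.one
  bang := D.bang

end PairingData

/-- Partial cartesian category (Curien–Obtulowicz), in its equational presentation. -/
structure PartialCartesianCategory (C : Type u) [Category.{v} C] extends PairingData C where
  /- pairing is stable under precomposition, and satisfies surjective pairing -/
  comp_pair : ∀ {V W X Y : C} (h : V ⟶ W) (f : W ⟶ X) (g : W ⟶ Y),
    h ≫ pair f g = pair (h ≫ f) (h ≫ g)
  pair_fst_snd : ∀ X Y : C, pair (fst X Y) (snd X Y) = 𝟙 (prod X Y)
  /- `snd ∘ ⟨f, g⟩` is `g` restricted to the domain of `f` -/
  pair_snd : ∀ {W X Y : C} (f : W ⟶ X) (g : W ⟶ Y),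
    pair f g ≫ snd X Y = toPairingData.restrict g f
  /- laws of the operation `↾` -/
  restrict_self : ∀ {W X : C} (f : W ⟶ X), toPairingData.restrict f f = f
  restrict_comm : ∀ {W X Y Z : C} (f : W ⟶ X) (g : W ⟶ Y) (h : W ⟶ Z),
    toPairingData.restrict (toPairingData.restrict f g) h =
      toPairingData.restrict (toPairingData.restrict f h) g
  restrict_restrict : ∀ {W X Y Z : C} (f : W ⟶ X) (g : W ⟶ Y) (h : W ⟶ Z),
    toPairingData.restrict f (toPairingData.restrict g h) =
      toPairingData.restrict (toPairingData.restrict f g) h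
  restrict_comp : ∀ {W X Y Z : C} (f : W ⟶ X) (g : W ⟶ Y) (k : X ⟶ Z),
    toPairingData.restrict f g ≫ k = toPairingData.restrict (f ≫ k) g
  /- the projections and the maps to `one` are everywhere defined -/
  restrict_fst : ∀ {X Y Z : C} (f : prod X Y ⟶ Z), toPairingData.restrict f (fst X Y) = f
  restrict_snd : ∀ {X Y Z : C} (f : prod X Y ⟶ Z), toPairingData.restrict f (snd X Y) = f
  restrict_bang : ∀ {X Z : C} (f : X ⟶ Z), toPairingData.restrict f (bang X) = f
  /- every map to `one` is a restriction of `bang` -/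
  eq_bang_restrict : ∀ {X : C} (f : X ⟶ one), f = toPairingData.restrict (bang X) f

/-! ### Symmetric monoidal structures and counital copy categories -/

/-- A counital copy structure on a symmetric monoidal category: monoidally natural maps
`X ⟶ X ⊗ X` that are coassociative, cocommutative, and have counits. -/
@[ext]
structure CopyStructure (C : Type u) [Category.{v} C] [MonoidalCategory C]
    [SymmetricCategory C] where
  copy : ∀ X : C, X ⟶ X ⊗ X
  counit : ∀ X : C, X ⟶ 𝟙_ C
  copy_natural : ∀ {X Y : C} (f : X ⟶ Y), f ≫ copy Y = copy X ≫ (f ⊗ₘ f)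
  copy_tensor : ∀ X Y : C, copy (X ⊗ Y) = (copy X ⊗ₘ copy Y) ≫ tensorμ X X Y Y
  copy_unit : copy (𝟙_ C) = (λ_ (𝟙_ C)).inv
  copy_assoc : ∀ X : C, copy X ≫ (X ◁ copy X) = copy X ≫ (copy X ▷ X) ≫ (α_ X X X).hom
  copy_comm : ∀ X : C, copy X ≫ (β_ X X).hom = copy X
  copy_counit_left : ∀ X : C, copy X ≫ (counit X ▷ X) = (λ_ X).inv
  copy_counit_right : ∀ X : C, copy X ≫ (X ◁ counit X) = (ρ_ X).inv

/-- A symmetric monoidal structure on a category, as a bundled object. -/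
structure SymmetricMonoidalStructure (C : Type u) [Category.{v} C] where
  monoidal : MonoidalCategory C
  symmetric : SymmetricCategory C

/-- Counital copy category. -/
structure CounitalCopyCategory (C : Type u) [Category.{v} C] where
  base : SymmetricMonoidalStructure C
  copyStructure : @CopyStructure C _ base.monoidal base.symmetric

/-- Products of arrows, diagonals, projections and maps to the unit of a counital copy category:
the projections are `X ⊗ Y ⟶ X ⊗ I ≅ X` and `X ⊗ Y ⟶ I ⊗ Y ≅ Y`, given by the counits. -/
def CounitalCopyCategory.toCartesianData {C : Type u} [Category.{v} C]
    (K : CounitalCopyCategory C) : CartesianData C :=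
  letI := K.base.monoidal
  letI := K.base.symmetric
  { prod := fun X Y => X ⊗ Y
    map := fun f g => f ⊗ₘ g
    diag := fun X => K.copyStructure.copy X
    fst := fun X Y => (X ◁ K.copyStructure.counit Y) ≫ (ρ_ X).hom
    snd := fun X Y => (K.copyStructure.counit X ▷ Y) ≫ (λ_ Y).hom
    one := 𝟙_ C
    bang := fun X => K.copyStructure.counit X }

/-- The isomorphisms `θ` between the tensor products and the units of two counital copy structures
on the same category make the identity functor a (strong) symmetric monoidal functor. -/
def CounitalCopyCategory.IdIsSymmetricMonoidal {C : Type u} [Category.{v} C]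
    (K L : CounitalCopyCategory C)
    (θ : CartesianData.Iso K.toCartesianData L.toCartesianData) : Prop :=
  ∃ F : @Functor.Braided C _ K.base.monoidal K.base.symmetric.toBraidedCategory
      C _ L.base.monoidal L.base.symmetric.toBraidedCategory (𝟭 C),
    (∀ X Y : C, @Functor.LaxMonoidal.μ C _ K.base.monoidal C _ L.base.monoidal (𝟭 C)
      F.toMonoidal.toLaxMonoidal X Y = (θ.prodIso X Y).inv) ∧
    @Functor.LaxMonoidal.ε C _ K.base.monoidal C _ L.base.monoidal (𝟭 C)
      F.toMonoidal.toLaxMonoidal = θ.oneIso.inv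

/-! ### The category `Copy V` -/

/-- The objects of `Copy V`: cocommutative comonoids in the symmetric monoidal category `V`. -/
structure Copy (V : Type u) [Category.{v} V] [MonoidalCategory V] [SymmetricCategory V] where
  X : V
  [comon : ComonObj X]
  [comm : IsCommComonObj X]

namespace Copy

open ComonObj

attribute [instance] Copy.comon Copy.comm

variable {V : Type u} [Category.{v} V] [MonoidalCategory V] [SymmetricCategory V]

/-- The morphisms of `Copy V`: homomorphisms of cosemigroups (counits need not be preserved). -/
@[ext]
structure Hom (A B : Copy V) where
  hom : A.X ⟶ B.X
  comul : hom ≫ Δ[B.X] = Δ[A.X] ≫ (hom ⊗ₘ hom)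

instance : Category (Copy V) where
  Hom A B := Hom A B
  id A := ⟨𝟙 A.X, by simp⟩
  comp f g := ⟨f.hom ≫ g.hom, by
    rw [Category.assoc, g.comul, ← Category.assoc, f.comul, Category.assoc,
      tensorHom_comp_tensorHom]⟩

@[simp] theorem id_hom (A : Copy V) : Hom.hom (𝟙 A) = 𝟙 A.X := rfl

@[simp] theorem comp_hom {A B D : Copy V} (f : A ⟶ B) (g : B ⟶ D) :
    Hom.hom (f ≫ g) = f.hom ≫ g.hom := rfl

@[ext] theorem hom_ext {A B : Copy V} (f g : A ⟶ B) (h : f.hom = g.hom) : f = g := Hom.ext h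

variable (V) in
/-- The forgetful functor `U : Copy V ⥤ V`. -/
@[simps]
def forget : Copy V ⥤ V where
  obj A := A.X
  map f := f.hom

instance : (forget V).Faithful where
  map_injective h := hom_ext _ _ h

/-- An isomorphism in `V` that is a homomorphism of cosemigroups is an isomorphism in `Copy V`. -/
@[simps]
def mkIso {A B : Copy V} (e : A.X ≅ B.X) (h : e.hom ≫ Δ[B.X] = Δ[A.X] ≫ (e.hom ⊗ₘ e.hom)) :
    A ≅ B where
  hom := ⟨e.hom, h⟩
  inv := ⟨e.inv, by
    rw [Iso.inv_comp_eq, ← Category.assoc, h, Category.assoc, tensorHom_comp_tensorHom]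
    simp⟩

/-- Tensor product of cocommutative comonoids: comultiplication `(1 ⊗ τ ⊗ 1)(δ ⊗ δ)` and counit
`ε ⊗ ε`. -/
abbrev tensor (A B : Copy V) : Copy V := ⟨A.X ⊗ B.X⟩

variable (V) in
/-- The unit object with its canonical comonoid structure. -/
def unit : Copy V :=
  letI := ComonObj.instTensorUnit V
  ⟨𝟙_ V⟩

theorem tensor_comul (A B : Copy V) :
    Δ[(tensor A B).X] = (Δ[A.X] ⊗ₘ Δ[B.X]) ≫ tensorμ A.X A.X B.X B.X :=
  Comon.tensorObj_comul A.X B.X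

theorem tensorμ_braiding (A B : V) :
    tensorμ A A B B ≫ ((β_ A B).hom ⊗ₘ (β_ A B).hom) =
      (β_ (A ⊗ A) (B ⊗ B)).hom ≫ tensorμ B B A A := by
  have inv : ∀ X Y : V, tensorμ X X Y Y = tensorδ X Y X Y := fun X Y => by
    simp [tensorμ, tensorδ, SymmetricCategory.braiding_swap_eq_inv_braiding Y X]
  have key : tensorμ A B A B ≫ (β_ (A ⊗ A) (B ⊗ B)).hom =
      ((β_ A B).hom ⊗ₘ (β_ A B).hom) ≫ tensorμ B A B A := by
    simp only [tensorμ, Category.assoc,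
      BraidedCategory.braiding_tensor_right_hom, BraidedCategory.braiding_tensor_left_hom,
      comp_whiskerRight, whisker_assoc, whiskerLeft_comp, pentagon_assoc,
      pentagon_inv_hom_hom_hom_inv_assoc, Iso.inv_hom_id_assoc, whiskerLeft_hom_inv_assoc]
    slice_lhs 3 4 =>
      rw [← whiskerLeft_comp, ← comp_whiskerRight, SymmetricCategory.symmetry]
    simp only [id_whiskerRight, whiskerLeft_id, Category.id_comp, Category.assoc,
      pentagon_inv_assoc, Iso.hom_inv_id_assoc]
    slice_lhs 1 2 =>
      rw [← associator_inv_naturality_left]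
    slice_lhs 2 3 =>
      rw [Iso.inv_hom_id]
    rw [Category.id_comp]
    slice_lhs 2 3 =>
      rw [← associator_naturality_right]
    slice_lhs 1 2 =>
      rw [← MonoidalCategory.tensorHom_def]
    simp only [Category.assoc]
  calc tensorμ A A B B ≫ ((β_ A B).hom ⊗ₘ (β_ A B).hom)
      = tensorδ A B A B ≫ (((β_ A B).hom ⊗ₘ (β_ A B).hom) ≫ tensorμ B A B A) ≫
          tensorδ B A B A := by
        rw [inv A B, Category.assoc, tensorμ_tensorδ, Category.comp_id]
    _ = (β_ (A ⊗ A) (B ⊗ B)).hom ≫ tensorμ B B A A := by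
        rw [← key, inv B A, Category.assoc, tensorδ_tensorμ_assoc]

theorem associator_comul (A B D : Copy V) :
    (α_ A.X B.X D.X).hom ≫ Δ[(tensor A (tensor B D)).X] =
      Δ[(tensor (tensor A B) D).X] ≫ ((α_ A.X B.X D.X).hom ⊗ₘ (α_ A.X B.X D.X).hom) := by
  have h := (α_ (Comon.mk A.X) (Comon.mk B.X) (Comon.mk D.X)).hom.isComonHom_hom.hom_comul
  have e : (α_ (Comon.mk A.X) (Comon.mk B.X) (Comon.mk D.X)).hom.hom = (α_ A.X B.X D.X).hom := by
    simp only [Comon.monoidal_associator_hom_hom]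
    change 𝟙 (A.X ⊗ B.X) ▷ D.X ≫ (α_ A.X B.X D.X).hom ≫ A.X ◁ 𝟙 (B.X ⊗ D.X) = _
    simp
  rw [e] at h
  exact h

theorem leftUnitor_comul (A : Copy V) :
    (λ_ A.X).hom ≫ Δ[A.X] =
      Δ[(tensor (unit V) A).X] ≫ ((λ_ A.X).hom ⊗ₘ (λ_ A.X).hom) := by
  have h := (λ_ (Comon.mk A.X)).hom.isComonHom_hom.hom_comul
  have e : (λ_ (Comon.mk A.X)).hom.hom = (λ_ A.X).hom := by
    simp only [Comon.monoidal_leftUnitor_hom_hom]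
    change 𝟙 (𝟙_ V) ▷ A.X ≫ (λ_ A.X).hom = _
    simp
  rw [e] at h
  exact h

theorem rightUnitor_comul (A : Copy V) :
    (ρ_ A.X).hom ≫ Δ[A.X] =
      Δ[(tensor A (unit V)).X] ≫ ((ρ_ A.X).hom ⊗ₘ (ρ_ A.X).hom) := by
  have h := (ρ_ (Comon.mk A.X)).hom.isComonHom_hom.hom_comul
  have e : (ρ_ (Comon.mk A.X)).hom.hom = (ρ_ A.X).hom := by
    simp only [Comon.monoidal_rightUnitor_hom_hom]
    change A.X ◁ 𝟙 (𝟙_ V) ≫ (ρ_ A.X).hom = _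
    simp
  rw [e] at h
  exact h

theorem braiding_comul (A B : Copy V) :
    (β_ A.X B.X).hom ≫ Δ[(tensor B A).X] =
      Δ[(tensor A B).X] ≫ ((β_ A.X B.X).hom ⊗ₘ (β_ A.X B.X).hom) := by
  rw [tensor_comul, tensor_comul, Category.assoc, tensorμ_braiding,
    BraidedCategory.braiding_naturality_assoc]

/-- Tensor product of cosemigroup homomorphisms. -/
@[simps]
def tensorHom {A B A' B' : Copy V} (f : A ⟶ A') (g : B ⟶ B') : tensor A B ⟶ tensor A' B' where
  hom := f.hom ⊗ₘ g.hom
  comul := by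
    rw [tensor_comul, tensor_comul, tensorHom_comp_tensorHom_assoc, f.comul, g.comul,
      ← tensorHom_comp_tensorHom_assoc, tensorμ_natural, Category.assoc]

instance : MonoidalCategoryStruct (Copy V) where
  tensorObj := tensor
  tensorUnit := unit V
  tensorHom f g := tensorHom f g
  whiskerLeft A _ _ f := tensorHom (𝟙 A) f
  whiskerRight f B := tensorHom f (𝟙 B)
  associator A B D := mkIso (α_ A.X B.X D.X) (associator_comul A B D)
  leftUnitor A := mkIso (λ_ A.X) (leftUnitor_comul A)
  rightUnitor A := mkIso (ρ_ A.X) (rightUnitor_comul A)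

/-- `U` strictly preserves the tensor product, the unit and the structure isomorphisms. -/
def inducingData : Monoidal.InducingFunctorData (forget V) where
  μIso _ _ := CategoryTheory.Iso.refl _
  εIso := CategoryTheory.Iso.refl _
  whiskerLeft_eq A B B' f := by
    change 𝟙 A.X ⊗ₘ f.hom = 𝟙 (A.X ⊗ B.X) ≫ (A.X ◁ f.hom) ≫ 𝟙 (A.X ⊗ B'.X)
    simp
  whiskerRight_eq {A A'} f B := by
    change f.hom ⊗ₘ 𝟙 B.X = 𝟙 (A.X ⊗ B.X) ≫ (f.hom ▷ B.X) ≫ 𝟙 (A'.X ⊗ B.X)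
    simp
  tensorHom_eq {A A' B B'} f g := by
    change f.hom ⊗ₘ g.hom = 𝟙 (A.X ⊗ B.X) ≫ (f.hom ⊗ₘ g.hom) ≫ 𝟙 (A'.X ⊗ B'.X)
    simp
  associator_eq A B D := by
    change (α_ A.X B.X D.X).hom =
      (𝟙 ((A.X ⊗ B.X) ⊗ D.X) ≫ (𝟙 (A.X ⊗ B.X) ⊗ₘ 𝟙 D.X)) ≫ (α_ A.X B.X D.X).hom ≫
        (𝟙 A.X ⊗ₘ 𝟙 (B.X ⊗ D.X)) ≫ 𝟙 (A.X ⊗ B.X ⊗ D.X)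
    simp
  leftUnitor_eq A := by
    change (λ_ A.X).hom = (𝟙 (𝟙_ V ⊗ A.X) ≫ (𝟙 (𝟙_ V) ⊗ₘ 𝟙 A.X)) ≫ (λ_ A.X).hom
    simp
  rightUnitor_eq A := by
    change (ρ_ A.X).hom = (𝟙 (A.X ⊗ 𝟙_ V) ≫ (𝟙 A.X ⊗ₘ 𝟙 (𝟙_ V))) ≫ (ρ_ A.X).hom
    simp

instance : MonoidalCategory (Copy V) := Monoidal.induced (forget V) inducingData

instance : (forget V).Monoidal := Monoidal.fromInducedMonoidal (forget V) inducingData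

instance : BraidedCategory (Copy V) :=
  BraidedCategory.ofFaithful (forget V) (fun A B => mkIso (β_ A.X B.X) (braiding_comul A B))
    (fun A B => by
      change 𝟙 _ ≫ (β_ A.X B.X).hom = (β_ A.X B.X).hom ≫ 𝟙 _
      simp)

instance : (forget V).Braided where
  braided A B := by
    change 𝟙 _ ≫ (β_ A.X B.X).hom = (β_ A.X B.X).hom ≫ 𝟙 _
    simp

instance : SymmetricCategory (Copy V) := SymmetricCategory.ofFaithful (forget V)

end Copy

namespace SymmetricMonoidalStructure

variable {C : Type u} [Category.{v} C] (M : SymmetricMonoidalStructure C)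

/-- The forgetful functor `U : Copy C ⥤ C` is an equivalence of categories. -/
def ForgetIsEquivalence : Prop :=
  letI := M.monoidal
  letI := M.symmetric
  (Copy.forget C).IsEquivalence

/-- There are a symmetric monoidal category `V` (in the universes `u'`, `v'`) and an equivalence
of symmetric monoidal categories `C ≌ Copy V`. -/
def IsEquivalentToCopy : Prop :=
  letI := M.monoidal
  letI := M.symmetric
  ∃ (V : Type u') (_ : Category.{v'} V) (_ : MonoidalCategory V) (_ : SymmetricCategory V)
    (F : C ⥤ Copy V) (_ : F.Braided), F.IsEquivalence

end SymmetricMonoidalStructure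

end PartialMaps

open PartialMaps

/-! Everything passes through one calculus: the pairing `⟨f,g⟩ = (f × g)Δ` and the idempotents `f̄`.
It consists of the rules that `p`, `q` are total, `p⟨f,g⟩ = f ḡ`, `q⟨f,g⟩ = g f̄`, `⟨f,g⟩h =
⟨fh,gh⟩`, `⟨p,q⟩ = 1`, with `f × g` and `Δ` expressed by pairing (`BinaryData.IsPairing`).
Restriction products, p-categories and partial cartesian categories each yield these rules, and the
rules give back the axioms. They make the projections jointly monic (`IsPairing.hom_ext`), so
identities between structural maps are checked componentwise as for genuine products, except that
idempotents must be carried along. Since `f̄ = p⟨1,f⟩`, the restriction is determined by the product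
data, and the round trips only have to preserve those data.

On the monoidal side, restriction products give a counital copy structure componentwise. Conversely
the counits of a copy category define projections with `(p ⊗ q)Δ = 1`; this forces the
associativity, symmetry and unit isomorphisms to be those built from `Δ`, `p`, `q`. The axioms of a
p-category follow, and the monoidal structure can be recovered from the product data.

The link with `Copy` is a uniqueness statement: in a copy category any `d : X ⟶ X ⊗ X` with a left
and a right counit equals `Δ` (`IsPairing.eq_diag`). Hence every cocommutative comonoid carries the
given comultiplication, every map is a homomorphism, and `U` is an equivalence. In the other
direction `Copy V` always has a copy structure, because cocommutativity makes a comultiplication a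
homomorphism of cosemigroups, and copy structures pull back along fully faithful braided functors.
Finally, two families of products for one restriction are compared by pairing the projections of one
in the other. -/

namespace PartialMaps

/-! ### Elementary laws of restriction -/

namespace RestrictionStructure

variable {C : Type u} [Category.{v} C] (R : RestrictionStructure C)

theorem ext_rst {R S : RestrictionStructure C}
    (h : ∀ {X Y : C} (f : X ⟶ Y), R.rst f = S.rst f) : R = S := by
  obtain ⟨r, _, _, _, _⟩ := R
  obtain ⟨s, _, _, _, _⟩ := S
  obtain rfl : @r = @s := by
    funext X Y f
    exact h f
  rfl

theorem rst_comp_self_assoc {X Y Z : C} (f : X ⟶ Y) (g : Y ⟶ Z) :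
    R.rst f ≫ f ≫ g = f ≫ g := by
  rw [← Category.assoc, R.rst_comp_self]

@[simp] theorem rst_id (X : C) : R.rst (𝟙 X) = 𝟙 X := by
  simpa using R.rst_comp_self (𝟙 X)

@[simp] theorem rst_idem {X Y : C} (f : X ⟶ Y) : R.rst f ≫ R.rst f = R.rst f := by
  rw [← R.rst_rst_comp, R.rst_comp_self]

@[simp] theorem rst_idem_assoc {X Y Z : C} (f : X ⟶ Y) (g : X ⟶ Z) :
    R.rst f ≫ R.rst f ≫ g = R.rst f ≫ g := by
  rw [← Category.assoc, R.rst_idem]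

@[simp] theorem rst_comp_rst_comp_self {X Y Z : C} (f : X ⟶ Y) (g : X ⟶ Z) :
    R.rst f ≫ R.rst g ≫ f = R.rst g ≫ f := by
  rw [← Category.assoc, R.rst_comm, Category.assoc, R.rst_comp_self]

@[simp] theorem rst_comp_rst_comp_rst_comp_self {X Y Z W : C} (f : X ⟶ Y) (g : X ⟶ Z)
    (h : X ⟶ W) : R.rst f ≫ R.rst g ≫ R.rst h ≫ f = R.rst g ≫ R.rst h ≫ f := by
  rw [← Category.assoc, R.rst_comm, Category.assoc, R.rst_comp_rst_comp_self]

@[simp] theorem rst_rst {X Y : C} (f : X ⟶ Y) : R.rst (R.rst f) = R.rst f := by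
  simpa using R.rst_rst_comp f (𝟙 X)

theorem rst_left_comm {X Y Z W : C} (f : X ⟶ Y) (g : X ⟶ Z) (h : X ⟶ W) :
    R.rst f ≫ R.rst g ≫ h = R.rst g ≫ R.rst f ≫ h := by
  rw [← Category.assoc, R.rst_comm, Category.assoc]

theorem comp_rst_assoc {X Y Z W : C} (f : X ⟶ Y) (g : Y ⟶ Z) (h : Y ⟶ W) :
    f ≫ R.rst g ≫ h = R.rst (f ≫ g) ≫ f ≫ h := by
  rw [← Category.assoc, R.comp_rst, Category.assoc]

@[simp] theorem rst_comp_rst_comp {X Y Z : C} (f : X ⟶ Y) (g : Y ⟶ Z) :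
    R.rst f ≫ R.rst (f ≫ g) = R.rst (f ≫ g) := by
  rw [← R.rst_rst_comp, R.rst_comp_self_assoc]

@[simp] theorem rst_comp_rst_comp_assoc {X Y Z W : C} (f : X ⟶ Y) (g : Y ⟶ Z) (h : X ⟶ W) :
    R.rst f ≫ R.rst (f ≫ g) ≫ h = R.rst (f ≫ g) ≫ h := by
  rw [← Category.assoc, R.rst_comp_rst_comp]

@[simp] theorem rst_comp_rst {X Y Z : C} (f : X ⟶ Y) (g : Y ⟶ Z) :
    R.rst (f ≫ R.rst g) = R.rst (f ≫ g) := by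
  rw [R.comp_rst, R.rst_rst_comp, R.rst_comm, R.rst_comp_rst_comp]

theorem rst_comp_of_total {X Y Z : C} (f : X ⟶ Y) {g : Y ⟶ Z} (hg : R.rst g = 𝟙 Y) :
    R.rst (f ≫ g) = R.rst f := by
  rw [← R.rst_comp_rst, hg, Category.comp_id]

/-- An idempotent that is split monic is trivial: precomposing the equation with `rst f` leaves its
left side unchanged. -/
theorem rst_eq_id_of_rst_comp_eq_id {X Y : C} (f : X ⟶ Y) {g : X ⟶ X}
    (h : R.rst f ≫ g = 𝟙 X) : R.rst f = 𝟙 X := by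
  have := congrArg (fun k => R.rst f ≫ k) h
  rw [R.rst_idem_assoc, h, Category.comp_id] at this
  exact this.symm

/-- The bookkeeping behind functoriality of `f × g`: `rst f` is absorbed by `f` and `rst g` by `rst
(g ≫ g')`, so both idempotents may be inserted freely. -/
theorem rst_comp_comp {W X X' Y Y' : C} (f : W ⟶ X) (f' : X ⟶ X') (g : W ⟶ Y) (g' : Y ⟶ Y') :
    R.rst (g ≫ g') ≫ f ≫ f' = (R.rst f ≫ R.rst (g ≫ g')) ≫ R.rst g ≫ f ≫ f' := by
  rw [Category.assoc, R.rst_left_comm (g ≫ g') g, R.rst_comp_rst_comp_assoc, R.rst_left_comm,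
    R.rst_comp_self_assoc]

end RestrictionStructure

/-! ### Restriction products and the pairing calculus -/

namespace BinaryData

variable {C : Type u} [Category.{v} C] (D : BinaryData C)

/-- The pairing `⟨f, g⟩ = (f × g) Δ`. -/
def pair {W X Y : C} (f : W ⟶ X) (g : W ⟶ Y) : W ⟶ D.prod X Y := D.diag W ≫ D.map f g

/-- The laws of the pairing operation derived from restriction products. -/
structure IsPairing (R : RestrictionStructure C) : Prop where
  rst_fst : ∀ X Y : C, R.rst (D.fst X Y) = 𝟙 _
  rst_snd : ∀ X Y : C, R.rst (D.snd X Y) = 𝟙 _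
  pair_fst : ∀ {W X Y : C} (f : W ⟶ X) (g : W ⟶ Y), D.pair f g ≫ D.fst X Y = R.rst g ≫ f
  pair_snd : ∀ {W X Y : C} (f : W ⟶ X) (g : W ⟶ Y), D.pair f g ≫ D.snd X Y = R.rst f ≫ g
  comp_pair : ∀ {V W X Y : C} (h : V ⟶ W) (f : W ⟶ X) (g : W ⟶ Y),
    h ≫ D.pair f g = D.pair (h ≫ f) (h ≫ g)
  pair_fst_snd : ∀ X Y : C, D.pair (D.fst X Y) (D.snd X Y) = 𝟙 _
  map_eq : ∀ {X X' Y Y' : C} (f : X ⟶ X') (g : Y ⟶ Y'),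
    D.map f g = D.pair (D.fst X Y ≫ f) (D.snd X Y ≫ g)
  diag_eq : ∀ X : C, D.diag X = D.pair (𝟙 X) (𝟙 X)

namespace IsRestrictionProduct

variable {D} {R : RestrictionStructure C} (h : D.IsRestrictionProduct R)
include h

/-- This is the last restriction axiom for `Δ` followed by `f × g`. Moving `Δ` past `f̄ × ḡ` leaves
an idempotent still to be computed; the next two lemmas do so when one factor is an identity. -/
theorem diag_map_rst {X Y Z : C} (f : X ⟶ Y) (g : X ⟶ Z) :
    D.diag X ≫ D.map (R.rst f) (R.rst g) = R.rst (D.diag X ≫ D.map f g) ≫ D.diag X := by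
  rw [← h.rst_map, R.comp_rst]

/-- Write `w` for the left side. Lax naturality of `q` bounds `w` above by `ḡ`, and lax naturality
of `Δ` at `ḡ` bounds it below, in the order on restriction idempotents where `a ≤ b` means `a = ab`.
-/
theorem rst_diag_map_right {X Y : C} (g : X ⟶ Y) :
    R.rst (D.diag X ≫ D.map (𝟙 X) g) = R.rst g := by
  have hw : D.diag X ≫ D.map (𝟙 X) (R.rst g) =
      R.rst (D.diag X ≫ D.map (𝟙 X) g) ≫ D.diag X := by
    simpa using h.diag_map_rst (𝟙 X) g
  have hsnd := congrArg (fun k => D.diag X ≫ k) (h.snd_lax (𝟙 X) (R.rst g))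
  simp only [R.rst_id, R.rst_rst] at hsnd
  rw [← Category.assoc, ← Category.assoc, hw, Category.assoc, Category.assoc, h.diag_snd,
    ← Category.assoc (D.diag X), h.diag_snd, Category.comp_id, Category.id_comp] at hsnd
  -- The extra factor `1 × ḡ` is absorbed by `ḡ × ḡ` on the right-hand side, but on the left it
  -- produces `w`.
  have hge := congrArg (fun k => R.rst (k ≫ D.map (𝟙 X) (R.rst g))) (h.diag_lax (R.rst g))
  simp only [R.rst_rst, Category.assoc, ← h.map_comp, R.rst_idem, Category.comp_id] at hge
  have hlax := h.diag_lax (R.rst g)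
  rw [R.rst_rst] at hlax
  rw [hw, ← hlax, R.rst_rst_comp, R.rst_rst_comp, R.rst_rst_comp, h.diag_total,
    Category.comp_id, Category.comp_id] at hge
  rw [hsnd, R.rst_comm, hge]

theorem rst_diag_map_left {X Y : C} (f : X ⟶ Y) :
    R.rst (D.diag X ≫ D.map f (𝟙 X)) = R.rst f := by
  have hw : D.diag X ≫ D.map (R.rst f) (𝟙 X) =
      R.rst (D.diag X ≫ D.map f (𝟙 X)) ≫ D.diag X := by
    simpa using h.diag_map_rst f (𝟙 X)
  have hfst := congrArg (fun k => D.diag X ≫ k) (h.fst_lax (R.rst f) (𝟙 X))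
  simp only [R.rst_id, R.rst_rst] at hfst
  rw [← Category.assoc, ← Category.assoc, hw, Category.assoc, Category.assoc, h.diag_fst,
    ← Category.assoc (D.diag X), h.diag_fst, Category.comp_id, Category.id_comp] at hfst
  have hge := congrArg (fun k => R.rst (k ≫ D.map (R.rst f) (𝟙 X))) (h.diag_lax (R.rst f))
  simp only [R.rst_rst, Category.assoc, ← h.map_comp, R.rst_idem, Category.comp_id] at hge
  have hlax := h.diag_lax (R.rst f)
  rw [R.rst_rst] at hlax
  rw [hw, ← hlax, R.rst_rst_comp, R.rst_rst_comp, R.rst_rst_comp, h.diag_total,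
    Category.comp_id, Category.comp_id] at hge
  rw [hfst, R.rst_comm, hge]

/-- Functoriality splits `f̄ × ḡ` into `f̄ × 1` and `1 × ḡ`, which the two preceding lemmas handle
separately. -/
theorem diag_map_rst_rst {X Y Z : C} (f : X ⟶ Y) (g : X ⟶ Z) :
    D.diag X ≫ D.map (R.rst f) (R.rst g) = R.rst f ≫ R.rst g ≫ D.diag X := by
  have hl := h.diag_map_rst f (𝟙 X)
  have hr := h.diag_map_rst (𝟙 X) g
  rw [h.rst_diag_map_left, R.rst_id] at hl
  rw [h.rst_diag_map_right, R.rst_id] at hr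
  have e : D.map (R.rst f) (R.rst g) = D.map (R.rst f) (𝟙 X) ≫ D.map (𝟙 X) (R.rst g) := by
    rw [← h.map_comp, Category.comp_id, Category.id_comp]
  rw [e, ← Category.assoc, hl, Category.assoc, hr]

/-- The lax square for `Δ` is strict: the factor `f̄` in it is already contained in `(f × f)Δ`,
because `f × f` absorbs `f̄ × f̄`. -/
theorem diag_natural {X Y : C} (f : X ⟶ Y) : f ≫ D.diag Y = D.diag X ≫ D.map f f := by
  have e : D.diag X ≫ D.map f f = D.diag X ≫ D.map (R.rst f) (R.rst f) ≫ D.map f f := by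
    rw [← h.map_comp, R.rst_comp_self]
  rw [h.diag_lax, e, ← Category.assoc (D.diag X) (D.map (R.rst f) _), h.diag_map_rst_rst,
    Category.assoc, Category.assoc, R.rst_idem_assoc]

theorem isPairing : D.IsPairing R where
  rst_fst := h.fst_total
  rst_snd := h.snd_total
  pair_fst {W X Y} f g := by
    rw [pair, Category.assoc, h.fst_lax, ← Category.assoc, h.diag_map_rst_rst]
    simp only [Category.assoc]
    rw [← Category.assoc (D.diag W), h.diag_fst, Category.id_comp, R.rst_left_comm,
      R.rst_comp_self]
  pair_snd {W X Y} f g := by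
    rw [pair, Category.assoc, h.snd_lax, ← Category.assoc, h.diag_map_rst_rst]
    simp only [Category.assoc]
    rw [← Category.assoc (D.diag W), h.diag_snd, Category.id_comp, R.rst_comp_self]
  comp_pair k f g := by
    rw [pair, pair, ← Category.assoc, h.diag_natural, Category.assoc, h.map_comp]
  pair_fst_snd X Y := h.diag_map_fst_snd X Y
  map_eq {X X' Y Y'} f g := by
    rw [pair, h.map_comp, ← Category.assoc, h.diag_map_fst_snd, Category.id_comp]
  diag_eq X := by rw [pair, h.map_id, Category.comp_id]

end IsRestrictionProduct

namespace IsPairing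

variable {D} {R : RestrictionStructure C} (h : D.IsPairing R)
include h

theorem pair_fst_assoc {W X Y Z : C} (f : W ⟶ X) (g : W ⟶ Y) (k : X ⟶ Z) :
    D.pair f g ≫ D.fst X Y ≫ k = R.rst g ≫ f ≫ k := by
  rw [← Category.assoc, h.pair_fst, Category.assoc]

theorem pair_snd_assoc {W X Y Z : C} (f : W ⟶ X) (g : W ⟶ Y) (k : Y ⟶ Z) :
    D.pair f g ≫ D.snd X Y ≫ k = R.rst f ≫ g ≫ k := by
  rw [← Category.assoc, h.pair_snd, Category.assoc]

theorem pair_eta {W X Y : C} (f : W ⟶ D.prod X Y) :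
    D.pair (f ≫ D.fst X Y) (f ≫ D.snd X Y) = f := by
  rw [← h.comp_pair, h.pair_fst_snd, Category.comp_id]

/-- The projections are jointly monic although pairing does not have them as strict inverses: a map
into the product is the pairing of its own components. -/
theorem hom_ext {W X Y : C} {f g : W ⟶ D.prod X Y} (h₁ : f ≫ D.fst X Y = g ≫ D.fst X Y)
    (h₂ : f ≫ D.snd X Y = g ≫ D.snd X Y) : f = g := by
  rw [← h.pair_eta f, ← h.pair_eta g, h₁, h₂]

/-- Composing with the total map `p` does not change the domain. -/
theorem rst_pair {W X Y : C} (f : W ⟶ X) (g : W ⟶ Y) :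
    R.rst (D.pair f g) = R.rst f ≫ R.rst g := by
  rw [← R.rst_comp_of_total (D.pair f g) (h.rst_fst X Y), h.pair_fst, R.rst_rst_comp, R.rst_comm]

theorem rst_eq_dom {X Y : C} (f : X ⟶ Y) : R.rst f = D.dom f := by
  have := h.pair_fst (𝟙 X) f
  rw [pair, Category.assoc, Category.comp_id] at this
  exact this.symm

theorem fst_natural {X X' : C} (Y : C) (f : X ⟶ X') :
    D.map f (𝟙 Y) ≫ D.fst X' Y = D.fst X Y ≫ f := by
  simp [h.map_eq, h.pair_fst, h.rst_snd]

theorem snd_natural (X : C) {Y Y' : C} (g : Y ⟶ Y') :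
    D.map (𝟙 X) g ≫ D.snd X Y' = D.snd X Y ≫ g := by
  simp [h.map_eq, h.pair_snd, h.rst_fst]

theorem isFunctorial : D.IsFunctorial where
  map_id X Y := by rw [h.map_eq, Category.comp_id, Category.comp_id, h.pair_fst_snd]
  map_comp {X X' X'' Y Y' Y''} f f' g g' := by
    rw [h.map_eq f g, h.map_eq f' g', h.comp_pair, h.map_eq]
    apply h.hom_ext
    · rw [h.pair_fst, h.pair_fst, h.pair_fst_assoc, h.pair_snd_assoc, R.rst_rst_comp]
      simpa using R.rst_comp_comp (D.fst X Y ≫ f) f' (D.snd X Y ≫ g) g'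
    · rw [h.pair_snd, h.pair_snd, h.pair_fst_assoc, h.pair_snd_assoc, R.rst_rst_comp]
      simpa using R.rst_comp_comp (D.snd X Y ≫ g) g' (D.fst X Y ≫ f) f'

theorem isRestrictionProduct : D.IsRestrictionProduct R where
  toIsFunctorial := h.isFunctorial
  rst_map {X X' Y Y'} f g := by
    rw [h.map_eq, h.rst_pair]
    apply h.hom_ext
    · rw [h.map_eq, h.pair_fst, Category.assoc, R.rst_comp_rst, R.comp_rst, R.rst_left_comm]
    · rw [h.map_eq, h.pair_snd, Category.assoc, R.rst_comp_rst, R.comp_rst]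
  diag_total X := by simp [RestrictionStructure.IsTotal, h.diag_eq, h.rst_pair]
  fst_total := h.rst_fst
  snd_total := h.rst_snd
  diag_fst X := by simp [h.diag_eq, h.pair_fst]
  diag_snd X := by simp [h.diag_eq, h.pair_snd]
  diag_map_fst_snd X Y := h.pair_fst_snd X Y
  fst_lax f g := by
    simp [h.map_eq, h.pair_fst, h.pair_fst_assoc, R.comp_rst, R.rst_rst_comp,
      h.rst_snd, R.rst_comp_self]
  snd_lax f g := by
    simp [h.map_eq, h.pair_snd, h.pair_snd_assoc, R.comp_rst, R.rst_rst_comp,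
      h.rst_fst, R.rst_comp_self]
  diag_lax f := by
    simp [h.diag_eq, h.comp_pair, h.map_eq, h.pair_fst_assoc, h.pair_snd_assoc, R.rst_comp_self]

theorem assoc_eq (X Y Z : C) : D.assoc X Y Z =
    D.pair (D.pair (D.fst _ _) (D.snd _ _ ≫ D.fst _ _)) (D.snd _ _ ≫ D.snd _ _) := by
  apply h.hom_ext <;> simp [assoc, h.diag_eq, h.comp_pair, h.map_eq, h.pair_fst_assoc,
    h.pair_fst, h.pair_snd, h.pair_snd_assoc, h.rst_pair, h.rst_fst, h.rst_snd,
    R.rst_comp_of_total]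

omit h in
theorem swap_eq (X Y : C) : D.swap X Y = D.pair (D.snd _ _) (D.fst _ _) := rfl

theorem isPCategory : D.IsPCategory where
  toIsFunctorial := h.isFunctorial
  diag_natural f := by
    simp [h.diag_eq, h.comp_pair, h.map_eq, h.pair_fst_assoc, h.pair_snd_assoc]
  fst_natural := h.fst_natural
  snd_natural := h.snd_natural
  diag_fst X := by simp [h.diag_eq, h.pair_fst]
  diag_snd X := by simp [h.diag_eq, h.pair_snd]
  diag_map_fst_snd X Y := h.pair_fst_snd X Y
  map_fst_fst X Y Z := by
    simp [h.map_eq, h.pair_fst, R.rst_comp_of_total, h.rst_fst, h.rst_snd]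
  map_snd_fst X Y Z := by
    simp [h.map_eq, h.pair_fst, R.rst_comp_of_total, h.rst_snd]
  map_fst_snd X Y Z := by
    simp [h.map_eq, h.pair_snd, R.rst_comp_of_total, h.rst_fst]
  map_snd_snd X Y Z := by
    simp [h.map_eq, h.pair_snd, R.rst_comp_of_total, h.rst_fst, h.rst_snd]
  assoc_natural f g k := by
    rw [h.assoc_eq, h.assoc_eq]
    refine h.hom_ext (h.hom_ext ?_ ?_) ?_ <;>
    simp [h.comp_pair, h.map_eq, h.pair_fst_assoc, h.pair_fst, h.pair_snd, h.pair_snd_assoc,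
      h.rst_pair, h.rst_fst, h.rst_snd, R.rst_comp_of_total, R.rst_rst_comp, R.rst_left_comm,
      R.rst_comm, R.rst_comp_self]
  swap_natural f g := by
    rw [swap_eq, swap_eq]
    refine h.hom_ext ?_ ?_ <;>
    simp [h.comp_pair, h.map_eq, h.pair_fst_assoc, h.pair_fst, h.pair_snd, h.pair_snd_assoc,
      h.rst_fst, h.rst_snd, R.rst_rst_comp]

end IsPairing

end BinaryData

/-! ### The restriction structure of a p-category -/

namespace BinaryData.IsPCategory

variable {C : Type u} [Category.{v} C] {D : BinaryData C} (h : D.IsPCategory)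
include h

theorem comp_pair {V W X Y : C} (k : V ⟶ W) (f : W ⟶ X) (g : W ⟶ Y) :
    k ≫ D.pair f g = D.pair (k ≫ f) (k ≫ g) := by
  rw [pair, pair, ← Category.assoc, h.diag_natural, Category.assoc, h.map_comp]

theorem pair_map {W X X' Y Y' : C} (f : W ⟶ X) (g : W ⟶ Y) (k : X ⟶ X') (l : Y ⟶ Y') :
    D.pair f g ≫ D.map k l = D.pair (f ≫ k) (g ≫ l) := by
  rw [pair, pair, Category.assoc, h.map_comp]

theorem diag_eq (X : C) : D.diag X = D.pair (𝟙 X) (𝟙 X) := by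
  rw [pair, h.map_id, Category.comp_id]

theorem pair_self {X Y : C} (f : X ⟶ Y) : D.pair f f = f ≫ D.diag Y :=
  (h.diag_natural f).symm

omit h in
theorem dom_eq {X Y : C} (f : X ⟶ Y) : D.dom f = D.pair (𝟙 X) f ≫ D.fst X Y := by
  rw [dom, pair, Category.assoc]

/-- Naturality of `p` in its first variable suffices: it lets `f` move out of `⟨f,g⟩ = (f ×
1)⟨1,g⟩`. -/
theorem pair_fst {W X Y : C} (f : W ⟶ X) (g : W ⟶ Y) :
    D.pair f g ≫ D.fst X Y = D.dom g ≫ f := by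
  rw [dom_eq, Category.assoc, ← h.fst_natural, ← Category.assoc, h.pair_map, Category.id_comp,
    Category.comp_id]

/-- Transfers facts about `p` to `q`. Factoring `q × p` as `(1 × p)(q × 1)` allows naturality of `q`
and then `q(q × 1) = q`. -/
theorem swap_snd (X Y : C) : D.swap X Y ≫ D.snd Y X = D.fst X Y := by
  have e : D.swap X Y = D.diag _ ≫ D.map (D.snd X Y) (𝟙 _) ≫ D.map (𝟙 _) (D.fst X Y) := by
    rw [← h.map_comp, Category.comp_id, Category.id_comp, swap]
  rw [e, Category.assoc, Category.assoc, h.snd_natural, ← Category.assoc (D.map _ _),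
    h.map_snd_snd, ← Category.assoc, h.diag_snd, Category.id_comp]

theorem pair_swap {W X Y : C} (f : W ⟶ X) (g : W ⟶ Y) :
    D.pair f g ≫ D.swap X Y = D.pair g f := by
  have e : D.diag W ≫ D.swap W W = D.diag W := by
    change D.diag W ≫ D.pair (D.snd W W) (D.fst W W) = _
    rw [h.comp_pair, h.diag_fst, h.diag_snd, ← h.diag_eq]
  rw [pair, Category.assoc, h.swap_natural, ← Category.assoc, e, pair]

theorem pair_snd {W X Y : C} (f : W ⟶ X) (g : W ⟶ Y) :
    D.pair f g ≫ D.snd X Y = D.dom f ≫ g := by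
  rw [← h.pair_swap, Category.assoc, h.swap_snd, h.pair_fst]

/-- The content of the axiom `p(1 × p) = p`: projections do not change domains. Totality of the
projections is the case `f = 1`. -/
theorem dom_comp_fst {W X Y : C} (f : W ⟶ D.prod X Y) : D.dom (f ≫ D.fst X Y) = D.dom f := by
  have e : D.pair (𝟙 W) (f ≫ D.fst X Y) = D.pair (𝟙 W) f ≫ D.map (𝟙 W) (D.fst X Y) := by
    rw [h.pair_map, Category.comp_id]
  rw [dom_eq, e, Category.assoc, h.map_fst_fst, dom_eq]

theorem dom_comp_snd {W X Y : C} (f : W ⟶ D.prod X Y) : D.dom (f ≫ D.snd X Y) = D.dom f := by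
  have e : D.pair (𝟙 W) (f ≫ D.snd X Y) = D.pair (𝟙 W) f ≫ D.map (𝟙 W) (D.snd X Y) := by
    rw [h.pair_map, Category.comp_id]
  rw [dom_eq, e, Category.assoc, h.map_snd_fst, dom_eq]

theorem dom_id (X : C) : D.dom (𝟙 X) = 𝟙 X := by
  rw [dom_eq, ← h.diag_eq, h.diag_fst]

theorem dom_fst (X Y : C) : D.dom (D.fst X Y) = 𝟙 _ := by
  rw [← Category.id_comp (D.fst X Y), h.dom_comp_fst, h.dom_id]

theorem dom_snd (X Y : C) : D.dom (D.snd X Y) = 𝟙 _ := by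
  rw [← Category.id_comp (D.snd X Y), h.dom_comp_snd, h.dom_id]

theorem assoc_eq (X Y Z : C) : D.assoc X Y Z =
    D.pair (D.map (𝟙 X) (D.fst Y Z)) (D.snd X (D.prod Y Z) ≫ D.snd Y Z) := by
  rw [assoc, ← h.map_comp, Category.comp_id, pair]

theorem assoc_fst_fst (X Y Z : C) : D.assoc X Y Z ≫ D.fst _ _ ≫ D.fst _ _ = D.fst _ _ := by
  rw [h.assoc_eq, ← Category.assoc, h.pair_fst, h.dom_comp_snd, h.dom_snd, Category.id_comp,
    h.map_fst_fst]

/-- By naturality of `α` it is enough to treat `⟨1,Δ⟩`, that is, coassociativity of `Δ`. -/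
theorem pair_assoc {W X Y Z : C} (f : W ⟶ X) (g : W ⟶ Y) (k : W ⟶ Z) :
    D.pair f (D.pair g k) ≫ D.assoc X Y Z = D.pair (D.pair f g) k := by
  have e : D.pair (𝟙 W) (D.diag W) ≫ D.assoc W W W = D.pair (D.diag W) (𝟙 W) := by
    have es : D.pair (𝟙 W) (D.diag W) ≫ D.snd _ _ = D.diag W := by
      rw [h.pair_snd, h.dom_id, Category.id_comp]
    rw [h.assoc_eq, h.comp_pair, h.pair_map, h.diag_fst, ← Category.assoc, es, h.diag_snd,
      Category.id_comp, ← h.diag_eq]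
  have e₁ : D.pair f (D.pair g k) = D.pair (𝟙 W) (D.diag W) ≫ D.map f (D.map g k) := by
    rw [h.pair_map, Category.id_comp, pair, pair, pair]
  rw [e₁, Category.assoc, h.assoc_natural, ← Category.assoc, e, h.pair_map, Category.id_comp]
  rfl

/-- The left side is the domain of `⟨g,f⟩`, hence `p⟨1,⟨g,f⟩⟩`. Rebracketing to `⟨⟨1,g⟩,f⟩` and
projecting twice separates the two domains. -/
theorem dom_dom_comp {X Y Z : C} (f : X ⟶ Y) (g : X ⟶ Z) :
    D.dom (D.dom f ≫ g) = D.dom f ≫ D.dom g := by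
  rw [← h.pair_fst g f, h.dom_comp_fst, dom_eq, ← h.assoc_fst_fst, ← Category.assoc,
    h.pair_assoc, ← Category.assoc, h.pair_fst, Category.assoc, ← dom_eq]

/-- The restriction structure of a p-category. -/
def restriction : RestrictionStructure C where
  rst f := D.dom f
  rst_comp_self f := by rw [← h.pair_fst, h.pair_self, Category.assoc, h.diag_fst, Category.comp_id]
  -- Both composites are the domain of `⟨f,g⟩`, read off through `q` and through `p`.
  rst_comm f g := by
    rw [← h.dom_dom_comp f g, ← h.pair_snd, h.dom_comp_snd, ← h.dom_comp_fst, h.pair_fst,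
      h.dom_dom_comp]
  rst_rst_comp := h.dom_dom_comp
  comp_rst f g := by
    rw [dom_eq, ← Category.assoc, h.comp_pair, Category.comp_id, h.pair_fst]

theorem isPairing : D.IsPairing h.restriction where
  rst_fst := h.dom_fst
  rst_snd := h.dom_snd
  pair_fst := h.pair_fst
  pair_snd := h.pair_snd
  comp_pair := h.comp_pair
  pair_fst_snd := h.diag_map_fst_snd
  map_eq f g := by rw [← h.pair_map, pair, h.diag_map_fst_snd, Category.id_comp]
  diag_eq := h.diag_eq

end BinaryData.IsPCategory

/-! ### Restriction terminal objects and one-element objects -/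

namespace CartesianData

variable {C : Type u} [Category.{v} C] {D : CartesianData C} {R : RestrictionStructure C}

theorem IsRestrictionTerminal.eq_rst_comp_bang (ht : D.IsRestrictionTerminal R) {X : C}
    (f : X ⟶ D.one) : f = R.rst f ≫ D.bang X := by
  rw [← ht.comp_bang, ht.bang_one, Category.comp_id]

theorem IsRestrictionTerminal.isOneElement (ht : D.IsRestrictionTerminal R) (h : D.IsPairing R) :
    D.IsOneElement where
  fst_inv X := by
    change _ ≫ D.pair _ _ = _
    apply h.hom_ext
    · rw [Category.assoc, h.pair_fst, ht.bang_total, Category.id_comp, Category.comp_id,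
        Category.id_comp]
    · rw [Category.assoc, h.pair_snd, R.rst_id, Category.id_comp, ht.comp_bang, Category.id_comp,
        ht.eq_rst_comp_bang (D.snd X D.one), h.rst_fst, h.rst_snd]
  inv_fst X := by
    change D.pair _ _ ≫ _ = _
    rw [h.pair_fst, ht.bang_total, Category.id_comp]

/-- One inverse law says that `t` is total. The other, projected by `q`, says `t p = q` on `X × T`;
precomposing with `⟨1,f⟩` gives `f = t f̄` for every `f : X ⟶ T`. -/
theorem IsOneElement.isRestrictionTerminal (ho : D.IsOneElement) (h : D.IsPairing R) :
    D.IsRestrictionTerminal R := by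
  have total : ∀ X : C, R.rst (D.bang X) = 𝟙 X := fun X => by
    have := ho.inv_fst X
    change D.pair _ _ ≫ _ = _ at this
    rwa [h.pair_fst, Category.comp_id] at this
  have fst_bang : ∀ X : C, D.fst X D.one ≫ D.bang X = D.snd X D.one := fun X => by
    have := congrArg (fun k => k ≫ D.snd X D.one) (ho.fst_inv X)
    change (_ ≫ D.pair _ _) ≫ _ = _ at this
    rwa [Category.assoc, h.pair_snd, R.rst_id, Category.id_comp, Category.id_comp] at this
  have eq_bang : ∀ {X : C} (f : X ⟶ D.one), f = R.rst f ≫ D.bang X := fun {X} f => by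
    have := congrArg (fun k => D.pair (𝟙 X) f ≫ k) (fst_bang X)
    rw [h.pair_fst_assoc, h.pair_snd, R.rst_id, Category.id_comp, Category.id_comp] at this
    exact this.symm
  refine ⟨total, ?_, fun {X Y} f => ?_⟩
  · simpa using (eq_bang (𝟙 D.one)).symm
  · rw [eq_bang (f ≫ D.bang Y), R.rst_comp_of_total f (total Y)]

/-- The pairing presentation of cartesian data. -/
def toPairingData (D : CartesianData C) : PairingData C where
  prod := D.prod
  fst := D.fst
  snd := D.snd
  pair f g := D.pair f g
  one := D.one
  bang := D.bang

theorem toPairingData_toCartesianData (h : D.IsPairing R) :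
    D.toPairingData.toCartesianData = D := by
  have hm := @h.map_eq
  have hd := h.diag_eq
  obtain ⟨⟨prod, map, diag, fst, snd⟩, one, bang⟩ := D
  simp only [toPairingData, PairingData.toCartesianData, CartesianData.mk.injEq,
    BinaryData.mk.injEq, heq_eq_eq, true_and, and_true]
  refine ⟨?_, ?_⟩
  · funext X X' Y Y' f g
    exact (hm f g).symm
  · funext X
    exact (hd X).symm

end CartesianData

namespace RestrictionProductCategory

variable {C : Type u} [Category.{v} C]

theorem isPairing (S : RestrictionProductCategory C) : S.data.IsPairing S.restriction :=
  S.isProduct.isPairing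

/-- The restriction carries no further information, since `f̄ = p(1 × f)Δ`. This is what makes each
round trip a comparison of product data only. -/
theorem ext_data {S S' : RestrictionProductCategory C} (e : S.data = S'.data) : S = S' := by
  have e' : S.restriction = S'.restriction := RestrictionStructure.ext_rst fun f => by
    rw [S.isPairing.rst_eq_dom, S'.isPairing.rst_eq_dom, e]
  obtain ⟨R, D, _, _⟩ := S
  obtain ⟨R', D', _, _⟩ := S'
  obtain rfl : D = D' := e
  obtain rfl : R = R' := e'
  rfl

end RestrictionProductCategory

/-- A p-category with a one-element object is a restriction category with products. -/
def PCategoryWithOne.toRestrictionProductCategory {C : Type u} [Category.{v} C]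
    (P : PCategoryWithOne C) : RestrictionProductCategory C where
  restriction := P.isPCategory.restriction
  data := P.data
  isProduct := P.isPCategory.isPairing.isRestrictionProduct
  isTerminal := P.isOneElement.isRestrictionTerminal P.isPCategory.isPairing

/-- Restriction categories with products are the same as p-categories with a one-element
object. -/
def equivPCategoryWithOne (C : Type u) [Category.{v} C] :
    RestrictionProductCategory C ≃ PCategoryWithOne C where
  toFun S := ⟨S.data, S.isPairing.isPCategory, S.isTerminal.isOneElement S.isPairing⟩
  invFun P := P.toRestrictionProductCategory
  left_inv _ := RestrictionProductCategory.ext_data rfl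
  right_inv _ := rfl

/-! ### Partial cartesian categories -/

namespace PartialCartesianCategory

variable {C : Type u} [Category.{v} C] (P : PartialCartesianCategory C)

theorem comp_restrict {V W X Y : C} (h : V ⟶ W) (f : W ⟶ X) (g : W ⟶ Y) :
    h ≫ P.restrict f g = P.restrict (h ≫ f) (h ≫ g) := by
  rw [PairingData.restrict, ← Category.assoc, P.comp_pair, PairingData.restrict]

/-- Reduces the binary operation `↾` to the idempotents `1 ↾ g`, which will be the restriction. -/
theorem restrict_eq {W X Y : C} (f : W ⟶ X) (g : W ⟶ Y) :
    P.restrict f g = P.restrict (𝟙 W) g ≫ f := by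
  rw [P.restrict_comp, Category.id_comp]

/-- The restriction structure of a partial cartesian category. -/
def restriction : RestrictionStructure C where
  rst f := P.restrict (𝟙 _) f
  rst_comp_self f := by rw [← P.restrict_eq, P.restrict_self]
  rst_comm f g := by rw [← P.restrict_eq, ← P.restrict_eq, P.restrict_comm]
  rst_rst_comp f g := by
    rw [← P.restrict_eq g f, ← P.restrict_eq (P.restrict (𝟙 _) g) f, P.restrict_restrict]
  comp_rst f g := by rw [P.comp_restrict, Category.comp_id, ← P.restrict_eq]

theorem toCartesianData_pair {W X Y : C} (f : W ⟶ X) (g : W ⟶ Y) :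
    P.toCartesianData.pair f g = P.pair f g := by
  have e₁ : P.pair (𝟙 W) (𝟙 W) ≫ P.fst W W = 𝟙 W := P.restrict_self _
  have e₂ : P.pair (𝟙 W) (𝟙 W) ≫ P.snd W W = 𝟙 W := by rw [P.pair_snd, P.restrict_self]
  change P.pair (𝟙 W) (𝟙 W) ≫ P.pair (P.fst W W ≫ f) (P.snd W W ≫ g) = _
  rw [P.comp_pair, ← Category.assoc, ← Category.assoc, e₁, e₂, Category.id_comp, Category.id_comp]

theorem isPairing : P.toCartesianData.IsPairing P.restriction where
  rst_fst _ _ := P.restrict_fst _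
  rst_snd _ _ := P.restrict_snd _
  pair_fst f g := by
    rw [toCartesianData_pair]
    exact P.restrict_eq f g
  pair_snd f g := by
    rw [toCartesianData_pair]
    exact (P.pair_snd f g).trans (P.restrict_eq g f)
  comp_pair k f g := by
    rw [toCartesianData_pair, toCartesianData_pair]
    exact P.comp_pair k f g
  pair_fst_snd X Y := by
    rw [toCartesianData_pair]
    exact P.pair_fst_snd X Y
  map_eq f g := by
    rw [toCartesianData_pair]
    rfl
  diag_eq X := by
    rw [toCartesianData_pair]
    rfl

theorem isRestrictionTerminal : P.toCartesianData.IsRestrictionTerminal P.restriction where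
  bang_total _ := P.restrict_bang _
  -- The identity of `T` is a restriction of `t_T`, and restricting to the domain of an identity
  -- does nothing.
  bang_one := ((P.eq_bang_restrict (𝟙 P.one)).trans (by
    have e : P.restrict (𝟙 P.one) (𝟙 P.one) = 𝟙 P.one := P.restrict_self _
    rw [P.restrict_eq, e, Category.id_comp]
    rfl)).symm
  comp_bang {X Y} f := by
    refine (P.eq_bang_restrict (f ≫ P.bang Y)).trans ((P.restrict_eq _ _).trans ?_)
    exact congrArg (fun k => k ≫ P.bang X)
      (P.restriction.rst_comp_of_total f (P.restrict_bang (𝟙 Y)))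

/-- A partial cartesian category is a restriction category with products. -/
def toRestrictionProductCategory : RestrictionProductCategory C where
  restriction := P.restriction
  data := P.toCartesianData
  isProduct := P.isPairing.isRestrictionProduct
  isTerminal := P.isRestrictionTerminal

theorem ext_toPairingData {P Q : PartialCartesianCategory C}
    (e : P.toPairingData = Q.toPairingData) : P = Q := by
  cases P
  cases Q
  cases e
  rfl

theorem toCartesianData_toPairingData : P.toCartesianData.toPairingData = P.toPairingData := by
  have e := @toCartesianData_pair C _ P
  obtain ⟨⟨prod, fst, snd, pair, one, bang⟩, _⟩ := P
  simp only [CartesianData.toPairingData, PairingData.toCartesianData, PairingData.mk.injEq,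
    heq_eq_eq, true_and, and_true]
  funext W X Y f g
  exact e f g

end PartialCartesianCategory

namespace RestrictionProductCategory

variable {C : Type u} [Category.{v} C] (S : RestrictionProductCategory C)

theorem restrict_toPairingData {W X Y : C} (f : W ⟶ X) (g : W ⟶ Y) :
    S.data.toPairingData.restrict f g = S.restriction.rst g ≫ f :=
  S.isPairing.pair_fst f g

/-- A restriction category with products is a partial cartesian category. -/
def toPartialCartesianCategory : PartialCartesianCategory C where
  toPairingData := S.data.toPairingData
  comp_pair := S.isPairing.comp_pair
  pair_fst_snd := S.isPairing.pair_fst_snd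
  pair_snd f g := (S.isPairing.pair_snd f g).trans (S.restrict_toPairingData g f).symm
  restrict_self f := by rw [restrict_toPairingData, S.restriction.rst_comp_self]
  restrict_comm f g h := by
    simp only [restrict_toPairingData]
    rw [S.restriction.rst_left_comm]
  restrict_restrict f g h := by
    simp only [restrict_toPairingData, S.restriction.rst_rst_comp, Category.assoc]
  restrict_comp f g k := by simp only [restrict_toPairingData, Category.assoc]
  restrict_fst {X Y Z} f := by
    refine (S.restrict_toPairingData f (S.data.fst X Y)).trans ?_
    exact (congrArg (fun k => k ≫ f) (S.isPairing.rst_fst X Y)).trans (Category.id_comp f)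
  restrict_snd {X Y Z} f := by
    refine (S.restrict_toPairingData f (S.data.snd X Y)).trans ?_
    exact (congrArg (fun k => k ≫ f) (S.isPairing.rst_snd X Y)).trans (Category.id_comp f)
  restrict_bang {X Z} f := by
    refine (S.restrict_toPairingData f (S.data.bang X)).trans ?_
    rw [S.isTerminal.bang_total, Category.id_comp]
  eq_bang_restrict f := by
    rw [restrict_toPairingData]
    exact S.isTerminal.eq_rst_comp_bang f

end RestrictionProductCategory

/-- Restriction categories with products are the same as partial cartesian categories. -/
def equivPartialCartesianCategory (C : Type u) [Category.{v} C] :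
    RestrictionProductCategory C ≃ PartialCartesianCategory C where
  toFun S := S.toPartialCartesianCategory
  invFun P := P.toRestrictionProductCategory
  left_inv S := RestrictionProductCategory.ext_data
    (CartesianData.toPairingData_toCartesianData S.isPairing)
  right_inv P := PartialCartesianCategory.ext_toPairingData P.toCartesianData_toPairingData

/-! ### From copy structures to p-categories -/

namespace CopyStructure

variable {C : Type u} [Category.{v} C] [MonoidalCategory C] [SymmetricCategory C]

-- The usual argument for units: after the unit isomorphisms, both counits equal `(e ⊗ e')d`. Since
-- counits are not assumed natural or monoidal, their behaviour on `X ⊗ Y` and on the unit is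
-- derived from this.
omit [SymmetricCategory C] in
theorem counit_unique {X : C} {d : X ⟶ X ⊗ X} {e e' : X ⟶ 𝟙_ C}
    (h : d ≫ e ▷ X = (λ_ X).inv) (h' : d ≫ X ◁ e' = (ρ_ X).inv) : e = e' := by
  have h₁ : (λ_ X).inv ≫ 𝟙_ C ◁ e' ≫ (λ_ (𝟙_ C)).hom = e' := by simp
  have h₂ : (ρ_ X).inv ≫ e ▷ 𝟙_ C ≫ (λ_ (𝟙_ C)).hom = e := by simp [unitors_equal]
  rw [← h₁, ← h, Category.assoc, ← whisker_exchange_assoc, ← Category.assoc, h', h₂]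

variable (K : CopyStructure C)

/-- The comonoid structure on an object given by a copy structure. -/
@[reducible]
def comonObj (X : C) : ComonObj X where
  counit := K.counit X
  comul := K.copy X
  counit_comul := K.copy_counit_left X
  comul_counit := K.copy_counit_right X
  comul_assoc := K.copy_assoc X

/-- The cocommutative comonoid on an object given by a copy structure. -/
def toCopy (X : C) : Copy C :=
  letI := K.comonObj X
  { X := X
    comm := ⟨K.copy_comm X⟩ }

/-- The right side is the counit of the tensor product comonoid, whose comultiplication is `copy (X
⊗ Y)` by monoidality of `copy`; counits are unique. -/
theorem counit_tensor (X Y : C) :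
    K.counit (X ⊗ Y) = (K.counit X ⊗ₘ K.counit Y) ≫ (λ_ (𝟙_ C)).hom := by
  let := K.comonObj X
  let := K.comonObj Y
  have h := ComonObj.comul_counit (X ⊗ Y)
  rw [Comon.tensorObj_comul X Y, Comon.tensorObj_counit X Y, Category.assoc] at h
  change (K.copy X ⊗ₘ K.copy Y) ≫ tensorμ X X Y Y ≫ _ = _ at h
  refine counit_unique (K.copy_counit_left (X ⊗ Y)) ?_
  rw [K.copy_tensor, Category.assoc]
  exact h

theorem counit_unit : K.counit (𝟙_ C) = 𝟙 (𝟙_ C) :=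
  counit_unique (K.copy_counit_left _) (by rw [K.copy_unit]; simp [unitors_inv_equal])

/-- The cartesian data underlying a copy structure. -/
def data : CartesianData C :=
  CounitalCopyCategory.toCartesianData ⟨⟨inferInstance, inferInstance⟩, K⟩

/-- The first projection. -/
def fst (X Y : C) : X ⊗ Y ⟶ X := (X ◁ K.counit Y) ≫ (ρ_ X).hom

/-- The second projection. -/
def snd (X Y : C) : X ⊗ Y ⟶ Y := (K.counit X ▷ Y) ≫ (λ_ Y).hom

theorem fst_natural {X X' : C} (f : X ⟶ X') (Y : C) : f ▷ Y ≫ K.fst X' Y = K.fst X Y ≫ f := by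
  simp [fst, ← whisker_exchange_assoc]

theorem snd_natural (X : C) {Y Y' : C} (g : Y ⟶ Y') : X ◁ g ≫ K.snd X Y' = K.snd X Y ≫ g := by
  simp [snd, whisker_exchange_assoc]

theorem copy_fst (X : C) : K.copy X ≫ K.fst X X = 𝟙 X := by
  rw [fst, ← Category.assoc, K.copy_counit_right, Iso.inv_hom_id]

theorem copy_snd (X : C) : K.copy X ≫ K.snd X X = 𝟙 X := by
  rw [snd, ← Category.assoc, K.copy_counit_left, Iso.inv_hom_id]

/-- Naturality of `tensorμ` moves the discarding of the middle factors before the interchange. The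
remaining symmetry acts on two copies of the unit, and coherence finishes. -/
theorem copy_tensorHom_fst_snd (X Y : C) :
    K.copy (X ⊗ Y) ≫ (K.fst X Y ⊗ₘ K.snd X Y) = 𝟙 (X ⊗ Y) := by
  have e : K.fst X Y ⊗ₘ K.snd X Y =
      ((𝟙 X ⊗ₘ K.counit Y) ⊗ₘ (K.counit X ⊗ₘ 𝟙 Y)) ≫ ((ρ_ X).hom ⊗ₘ (λ_ Y).hom) := by
    simp [fst, snd]
  rw [e, K.copy_tensor, Category.assoc, ← tensorμ_natural_assoc, tensorHom_comp_tensorHom_assoc,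
    id_tensorHom, tensorHom_id, K.copy_counit_right, K.copy_counit_left]
  simp only [tensorμ, braiding_tensorUnit_left]
  monoidal

theorem copy_tensorHom_eta {W X Y : C} (f : W ⟶ X ⊗ Y) :
    K.copy W ≫ ((f ≫ K.fst X Y) ⊗ₘ (f ≫ K.snd X Y)) = f := by
  rw [← tensorHom_comp_tensorHom, ← Category.assoc, ← K.copy_natural, Category.assoc,
    copy_tensorHom_fst_snd, Category.comp_id]

theorem fst_counit (X Y : C) : K.fst X Y ≫ K.counit X = K.counit (X ⊗ Y) := by
  rw [counit_tensor, fst, MonoidalCategory.tensorHom_def', Category.assoc, Category.assoc,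
    unitors_equal, rightUnitor_naturality]

theorem snd_counit (X Y : C) : K.snd X Y ≫ K.counit Y = K.counit (X ⊗ Y) := by
  rw [counit_tensor, snd, MonoidalCategory.tensorHom_def, Category.assoc, Category.assoc,
    leftUnitor_naturality]

/-- In its second variable `p` is natural only for counit-preserving maps, which include the
projections; this gives `p(1 × p) = p = p(1 × q)`. -/
theorem whiskerLeft_fst (X : C) {Y Y' : C} (f : Y ⟶ Y') (h : f ≫ K.counit Y' = K.counit Y) :
    X ◁ f ≫ K.fst X Y' = K.fst X Y := by
  rw [fst, ← whiskerLeft_comp_assoc, h, fst]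

theorem whiskerRight_snd {X X' : C} (f : X ⟶ X') (h : f ≫ K.counit X' = K.counit X) (Y : C) :
    f ▷ Y ≫ K.snd X' Y = K.snd X Y := by
  rw [snd, ← comp_whiskerRight_assoc, h, snd]

theorem associator_inv_fst (X Y Z : C) :
    (α_ X Y Z).inv ≫ K.fst (X ⊗ Y) Z = X ◁ K.fst Y Z := by
  simp [fst]

theorem associator_inv_snd (X Y Z : C) :
    (α_ X Y Z).inv ≫ K.snd (X ⊗ Y) Z = K.snd X (Y ⊗ Z) ≫ K.snd Y Z := by
  simp only [snd, counit_tensor, MonoidalCategory.tensorHom_def]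
  monoidal

theorem braiding_fst (X Y : C) : (β_ X Y).hom ≫ K.fst Y X = K.snd X Y := by
  rw [fst, snd, ← BraidedCategory.braiding_naturality_left_assoc, braiding_rightUnitor]

theorem braiding_snd (X Y : C) : (β_ X Y).hom ≫ K.snd Y X = K.fst X Y := by
  rw [fst, snd, ← BraidedCategory.braiding_naturality_right_assoc, braiding_leftUnitor]

/-- The components of `α⁻¹` under the projections are exactly the maps paired in `assoc`, and a map
is the pairing of its components. Naturality of `assoc` is thereby that of the associator. -/
theorem data_assoc (X Y Z : C) : K.data.assoc X Y Z = (α_ X Y Z).inv := by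
  change K.copy _ ≫ ((𝟙 X ⊗ₘ K.fst Y Z) ⊗ₘ K.snd X (Y ⊗ Z)) ≫ (𝟙 (X ⊗ Y) ⊗ₘ K.snd Y Z) = _
  rw [tensorHom_comp_tensorHom, Category.comp_id, id_tensorHom, ← associator_inv_fst,
    ← associator_inv_snd, copy_tensorHom_eta]

theorem data_swap (X Y : C) : K.data.swap X Y = (β_ X Y).hom := by
  change K.copy _ ≫ (K.snd X Y ⊗ₘ K.fst X Y) = _
  rw [← K.braiding_fst X Y, ← K.braiding_snd X Y, copy_tensorHom_eta]

theorem data_fst_one (X : C) : K.data.fst X K.data.one = (ρ_ X).hom := by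
  change K.fst X (𝟙_ C) = _
  rw [fst, counit_unit, whiskerLeft_id, Category.id_comp]

theorem data_one_snd (X : C) : K.data.snd K.data.one X = (λ_ X).hom := by
  change K.snd (𝟙_ C) X = _
  rw [snd, counit_unit, id_whiskerRight, Category.id_comp]

theorem isPCategory : K.data.IsPCategory where
  map_id X Y := id_tensorHom_id X Y
  map_comp f f' g g' := (tensorHom_comp_tensorHom f g f' g').symm
  diag_natural f := K.copy_natural f
  fst_natural Y f := (congrArg (fun k => k ≫ _) (tensorHom_id f Y)).trans (K.fst_natural f Y)
  snd_natural X _ _ g := (congrArg (fun k => k ≫ _) (id_tensorHom X g)).trans (K.snd_natural X g)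
  diag_fst := K.copy_fst
  diag_snd := K.copy_snd
  diag_map_fst_snd := K.copy_tensorHom_fst_snd
  map_fst_fst X Y Z := (congrArg (fun k => k ≫ _) (id_tensorHom X _)).trans
    (K.whiskerLeft_fst X _ (K.fst_counit Y Z))
  map_snd_fst X Y Z := (congrArg (fun k => k ≫ _) (id_tensorHom X _)).trans
    (K.whiskerLeft_fst X _ (K.snd_counit Y Z))
  map_fst_snd X Y Z := (congrArg (fun k => k ≫ _) (tensorHom_id _ Z)).trans
    (K.whiskerRight_snd _ (K.fst_counit X Y) Z)
  map_snd_snd X Y Z := (congrArg (fun k => k ≫ _) (tensorHom_id _ Z)).trans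
    (K.whiskerRight_snd _ (K.snd_counit X Y) Z)
  assoc_natural f g h := by
    rw [data_assoc, data_assoc]
    exact associator_inv_naturality f g h
  swap_natural f g := by
    rw [data_swap, data_swap]
    exact BraidedCategory.braiding_naturality f g

theorem isOneElement : K.data.IsOneElement := by
  have e : ∀ X : C, K.data.diag X ≫ K.data.map (𝟙 X) (K.data.bang X) = (ρ_ X).inv := fun X => by
    change K.copy X ≫ (𝟙 X ⊗ₘ K.counit X) = _
    rw [id_tensorHom, K.copy_counit_right]
  constructor
  · intro X
    rw [e, data_fst_one]
    exact Iso.hom_inv_id _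
  · intro X
    rw [e, data_fst_one]
    exact Iso.inv_hom_id _

/-- The restriction category with products underlying a copy structure. -/
def toRestrictionProductCategory : RestrictionProductCategory C :=
  PCategoryWithOne.toRestrictionProductCategory ⟨K.data, K.isPCategory, K.isOneElement⟩

end CopyStructure

namespace CounitalCopyCategory

variable {C : Type u} [Category.{v} C] (K : CounitalCopyCategory C)

theorem associator_inv_eq (X Y Z : C) :
    (K.base.monoidal.associator X Y Z).inv = K.toCartesianData.assoc X Y Z :=
  let := K.base.monoidal
  let := K.base.symmetric
  (K.copyStructure.data_assoc X Y Z).symm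

theorem braiding_hom_eq (X Y : C) :
    (K.base.symmetric.braiding X Y).hom = K.toCartesianData.swap X Y :=
  let := K.base.monoidal
  let := K.base.symmetric
  (K.copyStructure.data_swap X Y).symm

theorem leftUnitor_hom_eq (X : C) : (K.base.monoidal.leftUnitor X).hom =
    K.toCartesianData.snd K.toCartesianData.one X :=
  let := K.base.monoidal
  let := K.base.symmetric
  (K.copyStructure.data_one_snd X).symm

theorem rightUnitor_hom_eq (X : C) : (K.base.monoidal.rightUnitor X).hom =
    K.toCartesianData.fst X K.toCartesianData.one :=
  let := K.base.monoidal
  let := K.base.symmetric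
  (K.copyStructure.data_fst_one X).symm

theorem whiskerLeft_eq (X : C) {Y Z : C} (f : Y ⟶ Z) : K.base.monoidal.whiskerLeft X f =
    K.toCartesianData.map (𝟙 X) f :=
  let := K.base.monoidal
  (id_tensorHom X f).symm

theorem whiskerRight_eq {Y Z : C} (f : Y ⟶ Z) (X : C) : K.base.monoidal.whiskerRight f X =
    K.toCartesianData.map f (𝟙 X) :=
  let := K.base.monoidal
  (tensorHom_id f X).symm

theorem ext_toCartesianData {K L : CounitalCopyCategory C}
    (e : K.toCartesianData = L.toCartesianData) : K = L := by
  have ha := K.associator_inv_eq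
  have ha' := L.associator_inv_eq
  have hb := K.braiding_hom_eq
  have hb' := L.braiding_hom_eq
  have hl := K.leftUnitor_hom_eq
  have hl' := L.leftUnitor_hom_eq
  have hr := K.rightUnitor_hom_eq
  have hr' := L.rightUnitor_hom_eq
  have hwl := @K.whiskerLeft_eq
  have hwl' := @L.whiskerLeft_eq
  have hwr := @K.whiskerRight_eq
  have hwr' := @L.whiskerRight_eq
  obtain ⟨⟨@⟨⟨tO, wL, wR, tH, tU, a, l, r⟩, _, _, _, _, _, _, _, _, _, _⟩,
    @⟨⟨b, _, _, _, _⟩, _⟩⟩, ⟨copy, counit, _, _, _, _, _, _, _⟩⟩ := K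
  obtain ⟨⟨@⟨⟨tO', wL', wR', tH', tU', a', l', r'⟩, _, _, _, _, _, _, _, _, _, _⟩,
    @⟨⟨b', _, _, _, _⟩, _⟩⟩, ⟨copy', counit', _, _, _, _, _, _, _⟩⟩ := L
  -- Objects are identified first, so that the remaining fields have comparable types. Each
  -- structure isomorphism is then determined by its formula in `Δ`, `p`, `q`.
  obtain rfl : tO = tO' := congrArg (fun D => D.prod) e
  obtain rfl : tU = tU' := congrArg (fun D => D.one) e
  injection e with e e₁ e₂
  injection e with e₃ e₄ e₅ e₆ e₇
  obtain rfl : @tH = @tH' := e₄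
  obtain rfl : copy = copy' := e₅
  obtain rfl : counit = counit' := e₂
  obtain rfl : @wL = @wL' := by
    funext X Y Z f
    exact (hwl X f).trans (hwl' X f).symm
  obtain rfl : @wR = @wR' := by
    funext Y Z f X
    exact (hwr f X).trans (hwr' f X).symm
  obtain rfl : l = l' := by
    funext X
    exact Iso.ext ((hl X).trans ((congrFun (congrFun e₇ tU) X).trans (hl' X).symm))
  obtain rfl : r = r' := by
    funext X
    exact Iso.ext ((hr X).trans ((congrFun (congrFun e₆ X) tU).trans (hr' X).symm))
  obtain rfl : a = a' := by
    funext X Y Z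
    exact Iso.ext_inv ((ha X Y Z).trans (ha' X Y Z).symm)
  obtain rfl : b = b' := by
    funext X Y
    exact Iso.ext ((hb X Y).trans (hb' X Y).symm)
  rfl

end CounitalCopyCategory

/-! ### The symmetric monoidal structure of restriction products -/

namespace BinaryData.IsPairing

variable {C : Type u} [Category.{v} C] {D : BinaryData C} {R : RestrictionStructure C}
  (h : D.IsPairing R)
include h

/-- The associativity isomorphism `(X × Y) × Z ≅ X × (Y × Z)`. -/
def associator (X Y Z : C) : D.prod (D.prod X Y) Z ≅ D.prod X (D.prod Y Z) where
  hom := D.pair (D.fst _ _ ≫ D.fst _ _) (D.pair (D.fst _ _ ≫ D.snd _ _) (D.snd _ _))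
  inv := D.pair (D.pair (D.fst _ _) (D.snd _ _ ≫ D.fst _ _)) (D.snd _ _ ≫ D.snd _ _)
  hom_inv_id := by
    refine h.hom_ext (h.hom_ext ?_ ?_) ?_ <;>
    simp [h.comp_pair, h.pair_fst, h.pair_snd, h.pair_snd_assoc, h.rst_pair,
      h.rst_fst, h.rst_snd, R.rst_comp_of_total]
  inv_hom_id := by
    refine h.hom_ext ?_ (h.hom_ext ?_ ?_) <;>
    simp [h.comp_pair, h.pair_fst_assoc, h.pair_fst, h.pair_snd, h.rst_pair,
      h.rst_fst, h.rst_snd, R.rst_comp_of_total]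

/-- The symmetry isomorphism `X × Y ≅ Y × X`. -/
def braiding (X Y : C) : D.prod X Y ≅ D.prod Y X where
  hom := D.pair (D.snd _ _) (D.fst _ _)
  inv := D.pair (D.snd _ _) (D.fst _ _)
  hom_inv_id := by simp [h.comp_pair, h.pair_fst, h.pair_snd, h.rst_fst, h.rst_snd, h.pair_fst_snd]
  inv_hom_id := by simp [h.comp_pair, h.pair_fst, h.pair_snd, h.rst_fst, h.rst_snd, h.pair_fst_snd]

theorem associator_naturality {X X' Y Y' Z Z' : C} (f : X ⟶ X') (g : Y ⟶ Y') (k : Z ⟶ Z') :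
    D.map (D.map f g) k ≫ (h.associator X' Y' Z').hom =
      (h.associator X Y Z).hom ≫ D.map f (D.map g k) := by
  rw [← Iso.inv_comp_eq, ← Category.assoc, ← Iso.eq_comp_inv]
  have e := h.isPCategory.assoc_natural f g k
  rw [h.assoc_eq, h.assoc_eq] at e
  exact e.symm

/-- As with the hexagons below, the projections are jointly monic and every structural map is a
pairing of total maps, so all idempotents disappear and the ordinary cartesian computation applies.
-/
theorem pentagon (W X Y Z : C) :
    D.map (h.associator W X Y).hom (𝟙 Z) ≫ (h.associator W (D.prod X Y) Z).hom ≫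
        D.map (𝟙 W) (h.associator X Y Z).hom =
      (h.associator (D.prod W X) Y Z).hom ≫ (h.associator W X (D.prod Y Z)).hom := by
  refine h.hom_ext ?_ (h.hom_ext ?_ (h.hom_ext ?_ ?_)) <;>
  simp [associator, h.map_eq, h.comp_pair, h.pair_fst_assoc, h.pair_fst, h.pair_snd,
    h.pair_snd_assoc, h.rst_pair, h.rst_fst, h.rst_snd, R.rst_comp_of_total]

theorem hexagon_forward (X Y Z : C) :
    (h.associator X Y Z).hom ≫ (h.braiding X (D.prod Y Z)).hom ≫ (h.associator Y Z X).hom =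
      D.map (h.braiding X Y).hom (𝟙 Z) ≫ (h.associator Y X Z).hom ≫
        D.map (𝟙 Y) (h.braiding X Z).hom := by
  refine h.hom_ext ?_ (h.hom_ext ?_ ?_) <;>
  simp [associator, braiding, h.map_eq, h.comp_pair, h.pair_fst_assoc, h.pair_fst, h.pair_snd,
    h.pair_snd_assoc, h.rst_pair, h.rst_fst, h.rst_snd, R.rst_comp_of_total]

theorem hexagon_reverse (X Y Z : C) :
    (h.associator X Y Z).inv ≫ (h.braiding (D.prod X Y) Z).hom ≫ (h.associator Z X Y).inv =
      D.map (𝟙 X) (h.braiding Y Z).hom ≫ (h.associator X Z Y).inv ≫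
        D.map (h.braiding X Z).hom (𝟙 Y) := by
  refine h.hom_ext (h.hom_ext ?_ ?_) ?_ <;>
  simp [associator, braiding, h.map_eq, h.comp_pair, h.pair_fst_assoc, h.pair_fst, h.pair_snd,
    h.pair_snd_assoc, h.rst_pair, h.rst_fst, h.rst_snd, R.rst_comp_of_total]

/-- The last five factors spell out `tensorμ`, in the form required for monoidality of the copy
maps. -/
theorem diag_prod (X Y : C) : D.diag (D.prod X Y) =
    D.map (D.diag X) (D.diag Y) ≫ (h.associator X X (D.prod Y Y)).hom ≫
      D.map (𝟙 X) (h.associator X Y Y).inv ≫ D.map (𝟙 X) (D.map (h.braiding X Y).hom (𝟙 Y)) ≫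
        D.map (𝟙 X) (h.associator Y X Y).hom ≫ (h.associator X Y (D.prod X Y)).inv := by
  refine h.hom_ext (h.hom_ext ?_ ?_) (h.hom_ext ?_ ?_) <;>
  simp [associator, braiding, h.diag_eq, h.map_eq, h.comp_pair, h.pair_fst_assoc, h.pair_fst,
    h.pair_snd, h.pair_snd_assoc, h.rst_pair, h.rst_fst, h.rst_snd, R.rst_comp_of_total]

theorem diag_assoc (X : C) : D.diag X ≫ D.map (𝟙 X) (D.diag X) =
    D.diag X ≫ D.map (D.diag X) (𝟙 X) ≫ (h.associator X X X).hom := by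
  simp [associator, h.diag_eq, h.map_eq, h.comp_pair, h.pair_fst_assoc, h.pair_fst,
    h.pair_snd, h.rst_pair, h.rst_fst, h.rst_snd]

theorem diag_comm (X : C) : D.diag X ≫ (h.braiding X X).hom = D.diag X := by
  simp [braiding, h.diag_eq, h.comp_pair, h.pair_fst, h.pair_snd]

end BinaryData.IsPairing

namespace RestrictionProductCategory

variable {C : Type u} [Category.{v} C] (S : RestrictionProductCategory C)

/-- The left unit isomorphism. -/
def leftUnitor (X : C) : S.data.prod S.data.one X ≅ X where
  hom := S.data.snd S.data.one X
  inv := S.data.pair (S.data.bang X) (𝟙 X)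
  hom_inv_id := by
    have h := S.isPairing
    have ht := S.isTerminal
    apply h.hom_ext
    · rw [Category.assoc, h.pair_fst, S.restriction.rst_id, Category.id_comp, ht.comp_bang,
        Category.id_comp, ht.eq_rst_comp_bang (S.data.fst S.data.one X), h.rst_fst, h.rst_snd]
    · rw [Category.assoc, h.pair_snd, ht.bang_total, Category.id_comp, Category.comp_id,
        Category.id_comp]
  inv_hom_id := by rw [S.isPairing.pair_snd, S.isTerminal.bang_total, Category.id_comp]

/-- The right unit isomorphism. -/
def rightUnitor (X : C) : S.data.prod X S.data.one ≅ X where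
  hom := S.data.fst X S.data.one
  inv := S.data.pair (𝟙 X) (S.data.bang X)
  hom_inv_id := by
    have h := S.isPairing
    have ht := S.isTerminal
    apply h.hom_ext
    · rw [Category.assoc, h.pair_fst, ht.bang_total, Category.id_comp, Category.comp_id,
        Category.id_comp]
    · rw [Category.assoc, h.pair_snd, S.restriction.rst_id, Category.id_comp, ht.comp_bang,
        Category.id_comp, ht.eq_rst_comp_bang (S.data.snd X S.data.one), h.rst_fst, h.rst_snd]
  inv_hom_id := by rw [S.isPairing.pair_fst, S.isTerminal.bang_total, Category.id_comp]

/-- The tensor product given by restriction products. -/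
abbrev monoidalStruct : MonoidalCategoryStruct C where
  tensorObj := S.data.prod
  whiskerLeft X _ _ f := S.data.map (𝟙 X) f
  whiskerRight f X := S.data.map f (𝟙 X)
  tensorHom := S.data.map
  tensorUnit := S.data.one
  associator := S.isPairing.associator
  leftUnitor := S.leftUnitor
  rightUnitor := S.rightUnitor

theorem triangle (X Y : C) : (S.isPairing.associator X S.data.one Y).hom ≫
    S.data.map (𝟙 X) (S.leftUnitor Y).hom = S.data.map (S.rightUnitor X).hom (𝟙 Y) := by
  have h := S.isPairing
  refine h.hom_ext ?_ ?_ <;>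
  simp [BinaryData.IsPairing.associator, leftUnitor, rightUnitor, h.map_eq, h.comp_pair,
    h.pair_fst, h.pair_snd, h.pair_snd_assoc, h.rst_pair, h.rst_fst, h.rst_snd,
    RestrictionStructure.rst_comp_of_total]

/-- The monoidal structure given by restriction products. -/
abbrev monoidalCategory : MonoidalCategory C :=
  letI := S.monoidalStruct
  MonoidalCategory.ofTensorHom (C := C)
    (id_tensorHom_id := S.isPairing.isFunctorial.map_id)
    (id_tensorHom := fun _ _ _ _ => rfl)
    (tensorHom_id := fun _ _ => rfl)
    (tensorHom_comp_tensorHom := fun f g f' g' =>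
      (S.isPairing.isFunctorial.map_comp f f' g g').symm)
    (associator_naturality := S.isPairing.associator_naturality)
    (leftUnitor_naturality := S.isPairing.snd_natural _)
    (rightUnitor_naturality := S.isPairing.fst_natural _)
    (pentagon := S.isPairing.pentagon)
    (triangle := S.triangle)

/-- The symmetry given by restriction products. -/
abbrev symmetricCategory :
    letI := S.monoidalCategory
    SymmetricCategory C :=
  letI := S.monoidalCategory
  { braiding := S.isPairing.braiding
    braiding_naturality_right := fun X _ _ f => S.isPairing.isPCategory.swap_natural (𝟙 X) f
    braiding_naturality_left := fun f X => S.isPairing.isPCategory.swap_natural f (𝟙 X)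
    hexagon_forward := S.isPairing.hexagon_forward
    hexagon_reverse := S.isPairing.hexagon_reverse
    symmetry := fun X Y => (S.isPairing.braiding X Y).hom_inv_id }

theorem diag_one : S.data.diag S.data.one = (S.leftUnitor S.data.one).inv := by
  change _ = S.data.pair _ _
  rw [S.isPairing.diag_eq, S.isTerminal.bang_one]

/-- Guarantees that the projections rebuilt from the counits are the original ones. -/
theorem map_bang_fst (X Y : C) :
    S.data.map (𝟙 X) (S.data.bang Y) ≫ S.data.fst X S.data.one = S.data.fst X Y := by
  rw [S.isPairing.map_eq, S.isPairing.pair_fst,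
    S.restriction.rst_comp_of_total _ (S.isTerminal.bang_total Y), S.isPairing.rst_snd,
    Category.id_comp, Category.comp_id]

theorem map_bang_snd (X Y : C) :
    S.data.map (S.data.bang X) (𝟙 Y) ≫ S.data.snd S.data.one Y = S.data.snd X Y := by
  rw [S.isPairing.map_eq, S.isPairing.pair_snd,
    S.restriction.rst_comp_of_total _ (S.isTerminal.bang_total X), S.isPairing.rst_fst,
    Category.id_comp, Category.comp_id]

/-- The counital copy category given by restriction products. -/
def toCounitalCopyCategory : CounitalCopyCategory C where
  base := ⟨S.monoidalCategory, S.symmetricCategory⟩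
  copyStructure :=
    letI := S.monoidalCategory
    letI := S.symmetricCategory
    { copy := S.data.diag
      counit := S.data.bang
      copy_natural := S.isPairing.isPCategory.diag_natural
      copy_tensor := S.isPairing.diag_prod
      copy_unit := S.diag_one
      copy_assoc := S.isPairing.diag_assoc
      copy_comm := S.isPairing.diag_comm
      copy_counit_left := fun _ => rfl
      copy_counit_right := fun _ => rfl }

theorem toCartesianData_toCounitalCopyCategory :
    S.toCounitalCopyCategory.toCartesianData = S.data := by
  have hf := S.map_bang_fst
  have hs := S.map_bang_snd
  obtain ⟨R, ⟨⟨prod, map, diag, fst, snd⟩, one, bang⟩, _, _⟩ := S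
  change CartesianData.mk (BinaryData.mk prod map diag _ _) one bang = _
  congr
  · funext X Y
    exact hf X Y
  · funext X Y
    exact hs X Y

end RestrictionProductCategory

namespace CounitalCopyCategory

variable {C : Type u} [Category.{v} C] (K : CounitalCopyCategory C)

/-- The restriction category with products underlying a counital copy category. -/
def toRestrictionProductCategory : RestrictionProductCategory C :=
  letI := K.base.monoidal
  letI := K.base.symmetric
  K.copyStructure.toRestrictionProductCategory

end CounitalCopyCategory

/-- Restriction categories with products are the same as counital copy categories. -/
def equivCounitalCopyCategory (C : Type u) [Category.{v} C] :
    RestrictionProductCategory C ≃ CounitalCopyCategory C where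
  toFun S := S.toCounitalCopyCategory
  invFun K := K.toRestrictionProductCategory
  left_inv S := RestrictionProductCategory.ext_data S.toCartesianData_toCounitalCopyCategory
  right_inv K := CounitalCopyCategory.ext_toCartesianData
    K.toRestrictionProductCategory.toCartesianData_toCounitalCopyCategory

/-! ### Uniqueness of comultiplications, and the forgetful functor from `Copy` -/

theorem BinaryData.IsPairing.eq_diag {C : Type u} [Category.{v} C] {D : BinaryData C}
    {R : RestrictionStructure C} (h : D.IsPairing R) {X Y Z : C} {d : X ⟶ D.prod X X}
    {e : X ⟶ Y} {e' : X ⟶ Z} (hl : d ≫ D.map e (𝟙 X) ≫ D.snd Y X = 𝟙 X)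
    (hr : d ≫ D.map (𝟙 X) e' ≫ D.fst X Z = 𝟙 X) : d = D.diag X := by
  -- Each hypothesis becomes an idempotent followed by a component of `d`, equal to `1`. The
  -- idempotent is then split monic, hence trivial, so both components of `d` are identities.
  -- Neither totality of `e`, `e'` nor coassociativity of `d` is needed.
  rw [h.map_eq, h.pair_snd, Category.comp_id, R.comp_rst_assoc] at hl
  rw [h.map_eq, h.pair_fst, Category.comp_id, R.comp_rst_assoc] at hr
  have hl' := R.rst_eq_id_of_rst_comp_eq_id _ hl
  have hr' := R.rst_eq_id_of_rst_comp_eq_id _ hr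
  rw [hl', Category.id_comp] at hl
  rw [hr', Category.id_comp] at hr
  rw [h.diag_eq, ← h.pair_eta d, hl, hr]

namespace CopyStructure

section

variable {C : Type u} [Category.{v} C] [MonoidalCategory C] [SymmetricCategory C]
  (K : CopyStructure C)

theorem eq_copy {X : C} {d : X ⟶ X ⊗ X} {e e' : X ⟶ 𝟙_ C}
    (hl : d ≫ e ▷ X = (λ_ X).inv) (hr : d ≫ X ◁ e' = (ρ_ X).inv) : d = K.copy X := by
  refine K.toRestrictionProductCategory.isPairing.eq_diag (e := e) (e' := e') ?_ ?_
  · change d ≫ (e ⊗ₘ 𝟙 X) ≫ K.data.snd K.data.one X = _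
    rw [data_one_snd, tensorHom_id, ← Category.assoc, hl, Iso.inv_hom_id]
  · change d ≫ (𝟙 X ⊗ₘ e') ≫ K.data.fst X K.data.one = _
    rw [data_fst_one, id_tensorHom, ← Category.assoc, hr, Iso.inv_hom_id]

theorem unique (K K' : CopyStructure C) : K = K' := by
  have hc : ∀ X, K.copy X = K'.copy X := fun X =>
    K'.eq_copy (K.copy_counit_left X) (K.copy_counit_right X)
  ext X
  · exact hc X
  · exact counit_unique (K.copy_counit_left X) (by rw [hc, K'.copy_counit_right])

theorem comul_eq_copy (A : Copy C) : ComonObj.comul = K.copy A.X :=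
  K.eq_copy (ComonObj.counit_comul A.X) (ComonObj.comul_counit A.X)

-- Every comultiplication is the given copy map, so naturality of `copy` makes every map a
-- homomorphism; surjectivity on objects holds because each object carries the comonoid `K.toCopy
-- X`.
include K in
theorem forget_isEquivalence : (Copy.forget C).IsEquivalence where
  full := ⟨fun {A B} f => ⟨⟨f, by
    rw [K.comul_eq_copy A, K.comul_eq_copy B]
    exact K.copy_natural f⟩, rfl⟩⟩
  essSurj := ⟨fun X => ⟨K.toCopy X, ⟨Iso.refl X⟩⟩⟩

end

section

open Functor.LaxMonoidal Functor.OplaxMonoidal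

variable {C : Type u} [Category.{v} C] [MonoidalCategory C] [SymmetricCategory C]
  {D : Type u'} [Category.{v'} D] [MonoidalCategory D] [SymmetricCategory D]
  (K : CopyStructure D) (F : C ⥤ D) [F.Braided] [F.Full] [F.Faithful]

/-- A copy structure pulled back along a fully faithful symmetric monoidal functor. -/
noncomputable def pullback : CopyStructure C where
  copy X := F.preimage (K.copy (F.obj X) ≫ μ F X X)
  counit X := F.preimage (K.counit (F.obj X) ≫ ε F)
  copy_natural f := F.map_injective (by
    simp only [Functor.map_comp, Functor.map_preimage, Functor.Monoidal.map_tensor, Category.assoc,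
      Functor.Monoidal.μ_δ_assoc]
    rw [← Category.assoc, K.copy_natural, Category.assoc])
  copy_tensor X Y := F.map_injective (by
    rw [← cancel_epi (μ F X Y)]
    simp only [Functor.map_comp, Functor.map_preimage, Functor.Monoidal.map_tensor, Category.assoc,
      Functor.Monoidal.μ_δ_assoc]
    -- Braidedness of `F` enters here, through the compatibility of `μ` with the middle interchange.
    rw [← tensorHom_comp_tensorHom, Category.assoc, ← tensorμ_comp_μ_tensorHom_μ_comp_μ,
      ← Category.assoc, K.copy_natural, Category.assoc, K.copy_tensor, Category.assoc])
  copy_unit := F.map_injective (by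
    rw [← cancel_epi (ε F), Functor.map_preimage, ← Category.assoc, K.copy_natural, K.copy_unit,
      Functor.Monoidal.map_leftUnitor_inv, Category.assoc, MonoidalCategory.tensorHom_def',
      Category.assoc, leftUnitor_inv_naturality_assoc])
  copy_assoc X := F.map_injective (by
    simp only [Functor.map_comp, Functor.map_preimage, Functor.Monoidal.map_whiskerLeft,
      Functor.Monoidal.map_whiskerRight, Functor.Monoidal.map_associator, Category.assoc,
      Functor.Monoidal.μ_δ_assoc, comp_whiskerRight, whiskerLeft_comp]
    rw [← comp_whiskerRight_assoc (μ F X X), Functor.Monoidal.μ_δ, id_whiskerRight,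
      Category.id_comp, reassoc_of% K.copy_assoc (F.obj X)])
  copy_comm X := F.map_injective (by
    rw [Functor.map_comp, Functor.map_preimage, Category.assoc, Functor.LaxBraided.braided,
      ← Category.assoc, K.copy_comm])
  copy_counit_left X := F.map_injective (by
    rw [Functor.map_comp, Functor.Monoidal.map_whiskerRight, Functor.map_preimage,
      Functor.map_preimage, Category.assoc, Functor.Monoidal.μ_δ_assoc, comp_whiskerRight,
      Category.assoc, Functor.Monoidal.map_leftUnitor_inv, ← K.copy_counit_left, Category.assoc])
  copy_counit_right X := F.map_injective (by
    rw [Functor.map_comp, Functor.Monoidal.map_whiskerLeft, Functor.map_preimage,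
      Functor.map_preimage, Category.assoc, Functor.Monoidal.μ_δ_assoc, whiskerLeft_comp,
      Category.assoc, Functor.Monoidal.map_rightUnitor_inv, ← K.copy_counit_right, Category.assoc])

end

end CopyStructure

/-! ### The canonical copy structure on `Copy V` -/

namespace Copy

open ComonObj

variable {V : Type u} [Category.{v} V] [MonoidalCategory V] [SymmetricCategory V]

/-- This says that `Δ` is itself a morphism of `Copy V`. By coassociativity the two middle copies of
the four come from a single `Δ`, so cocommutativity absorbs their exchange. -/
theorem comul_comul_tensorμ (A : Copy V) :
    Δ[A.X] ≫ (Δ[A.X] ⊗ₘ Δ[A.X]) ≫ tensorμ A.X A.X A.X A.X = Δ[A.X] ≫ (Δ[A.X] ⊗ₘ Δ[A.X]) := by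
  have e : Δ[A.X] ≫ (Δ[A.X] ⊗ₘ Δ[A.X]) ≫ (α_ A.X A.X (A.X ⊗ A.X)).hom =
      Δ[A.X] ≫ A.X ◁ (Δ[A.X] ≫ Δ[A.X] ▷ A.X) ≫ A.X ◁ (α_ A.X A.X A.X).hom := by
    rw [← whiskerLeft_comp, Category.assoc, ← comul_assoc, whiskerLeft_comp, comul_assoc_assoc,
      MonoidalCategory.tensorHom_def, Category.assoc, associator_naturality_right]
  have e' : Δ[A.X] ≫ (Δ[A.X] ⊗ₘ Δ[A.X]) =
      Δ[A.X] ≫ A.X ◁ (Δ[A.X] ≫ Δ[A.X] ▷ A.X) ≫ A.X ◁ (α_ A.X A.X A.X).hom ≫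
        (α_ A.X A.X (A.X ⊗ A.X)).inv := by
    rw [← reassoc_of% e, Iso.hom_inv_id, Category.comp_id]
  rw [tensorμ, reassoc_of% e, whiskerLeft_hom_inv_assoc, ← whiskerLeft_comp_assoc,
    Category.assoc, ← comp_whiskerRight, IsCommComonObj.comul_comm, e']

theorem counit_comul_unit (A : Copy V) :
    ε[A.X] ≫ (λ_ (𝟙_ V)).inv = Δ[A.X] ≫ (ε[A.X] ⊗ₘ ε[A.X]) := by
  rw [MonoidalCategory.tensorHom_def, ← Category.assoc, counit_comul, leftUnitor_inv_naturality]

@[simp] theorem whiskerLeft_hom (A : Copy V) {B B' : Copy V} (f : B ⟶ B') :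
    (A ◁ f).hom = A.X ◁ f.hom :=
  id_tensorHom A.X f.hom

@[simp] theorem whiskerRight_hom {B B' : Copy V} (f : B ⟶ B') (A : Copy V) :
    (f ▷ A).hom = f.hom ▷ A.X :=
  tensorHom_id f.hom A.X

theorem tensorμ_hom (A B A' B' : Copy V) :
    (tensorμ A B A' B').hom = tensorμ A.X B.X A'.X B'.X := by
  simp only [tensorμ, comp_hom, whiskerLeft_hom, whiskerRight_hom]
  rfl

variable (V) in
/-- The canonical copy structure on `Copy V`. -/
def copyStructure : CopyStructure (Copy V) where
  copy A := ⟨Δ[A.X], by rw [tensor_comul]; exact A.comul_comul_tensorμ⟩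
  counit A := ⟨ε[A.X], A.counit_comul_unit⟩
  copy_natural f := hom_ext _ _ f.comul
  copy_tensor A B := hom_ext _ _ (by
    rw [comp_hom, tensorμ_hom]
    exact tensor_comul A B)
  copy_unit := rfl
  copy_assoc A := hom_ext _ _ (by
    rw [comp_hom, comp_hom, comp_hom, whiskerLeft_hom, whiskerRight_hom]
    exact comul_assoc A.X)
  copy_comm A := hom_ext _ _ (IsCommComonObj.comul_comm A.X)
  copy_counit_left A := hom_ext _ _ (by
    rw [comp_hom, whiskerRight_hom]
    exact counit_comul A.X)
  copy_counit_right A := hom_ext _ _ (by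
    rw [comp_hom, whiskerLeft_hom]
    exact comul_counit A.X)

end Copy

/-- The inverse of a braided monoidal equivalence is braided. -/
@[reducible]
noncomputable def inverseBraided {C : Type u} [Category.{v} C] [MonoidalCategory C]
    [BraidedCategory C] {D : Type u'} [Category.{v'} D] [MonoidalCategory D] [BraidedCategory D]
    (e : C ≌ D) (_ : e.functor.Braided) : e.inverse.Braided :=
  letI := e.inverseMonoidal
  { braided := fun X Y => by
      have hμ : ∀ X Y : D, Functor.LaxMonoidal.μ e.inverse X Y =
        e.unit.app _ ≫ e.inverse.map (Functor.OplaxMonoidal.δ e.functor _ _ ≫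
          (e.counit.app X ⊗ₘ e.counit.app Y)) := fun X Y => rfl
      have hu : (β_ (e.inverse.obj X) (e.inverse.obj Y)).hom ≫ e.unit.app _ =
          e.unit.app _ ≫ e.inverse.map (e.functor.map (β_ _ _).hom) :=
        e.unit.naturality _
      -- Braidedness of `e.functor` combined with naturality of the symmetry, to be used at the
      -- components of the counit.
      have key : ∀ (a : e.functor.obj (e.inverse.obj X) ⟶ X)
          (b : e.functor.obj (e.inverse.obj Y) ⟶ Y),
          (Functor.OplaxMonoidal.δ e.functor _ _ ≫ (a ⊗ₘ b)) ≫ (β_ X Y).hom =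
            e.functor.map (β_ _ _).hom ≫ Functor.OplaxMonoidal.δ e.functor _ _ ≫ (b ⊗ₘ a) :=
        fun a b => by
          rw [Category.assoc, BraidedCategory.braiding_naturality, Functor.map_braiding,
            Category.assoc, Category.assoc, Functor.Monoidal.μ_δ_assoc]
      rw [hμ, hμ, reassoc_of% hu, Category.assoc, ← Functor.map_comp, ← Functor.map_comp]
      exact congrArg (fun k => e.unit.app _ ≫ e.inverse.map k) (key _ _) }

/-! ### Equivalence with some `Copy V` -/

namespace SymmetricMonoidalStructure

variable {C : Type u} [Category.{v} C] (M : SymmetricMonoidalStructure C)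

/-- Here `V` is `C` itself and the equivalence is an inverse of `U`, so no larger universe is
needed. -/
theorem ForgetIsEquivalence.isEquivalentToCopy {M : SymmetricMonoidalStructure C}
    (h : M.ForgetIsEquivalence) : IsEquivalentToCopy.{u, v, u, v} M := by
  let := M.monoidal
  let := M.symmetric
  have : (Copy.forget C).IsEquivalence := h
  let e := (Copy.forget C).asEquivalence
  exact ⟨C, inferInstance, M.monoidal, M.symmetric, e.inverse,
    inverseBraided e (inferInstance : (Copy.forget C).Braided), inferInstance⟩

/-- The canonical copy structure of `Copy V` is pulled back along the equivalence. The result no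
longer mentions `V`, whence the independence of its universes. -/
theorem IsEquivalentToCopy.nonempty_copyStructure {M : SymmetricMonoidalStructure C}
    (h : IsEquivalentToCopy.{u, v, u', v'} M) :
    Nonempty (@CopyStructure C _ M.monoidal M.symmetric) := by
  let := M.monoidal
  let := M.symmetric
  obtain ⟨V, _, _, _, F, _, _⟩ := h
  exact ⟨(Copy.copyStructure V).pullback F⟩

theorem forgetIsEquivalence_of_copyStructure
    (K : @CopyStructure C _ M.monoidal M.symmetric) : M.ForgetIsEquivalence :=
  let := M.monoidal
  let := M.symmetric
  K.forget_isEquivalence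

theorem IsEquivalentToCopy.forgetIsEquivalence {M : SymmetricMonoidalStructure C}
    (h : IsEquivalentToCopy.{u, v, u', v'} M) : M.ForgetIsEquivalence :=
  h.nonempty_copyStructure.elim M.forgetIsEquivalence_of_copyStructure

theorem ForgetIsEquivalence.nonempty_copyStructure {M : SymmetricMonoidalStructure C}
    (h : M.ForgetIsEquivalence) : Nonempty (@CopyStructure C _ M.monoidal M.symmetric) :=
  h.isEquivalentToCopy.nonempty_copyStructure

end SymmetricMonoidalStructure

theorem CounitalCopyCategory.ext_base {C : Type u} [Category.{v} C]
    {K L : CounitalCopyCategory C} (e : K.base = L.base) : K = L := by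
  obtain ⟨M, k⟩ := K
  obtain ⟨N, l⟩ := L
  obtain rfl : M = N := e
  let := M.monoidal
  let := M.symmetric
  rw [k.unique l]

/-- Counital copy categories are the same as symmetric monoidal structures for which the forgetful
functor from `Copy C` is an equivalence. -/
noncomputable def equivForgetIsEquivalence (C : Type u) [Category.{v} C] :
    CounitalCopyCategory C ≃ {M : SymmetricMonoidalStructure C // M.ForgetIsEquivalence} where
  toFun K := ⟨K.base, K.base.forgetIsEquivalence_of_copyStructure K.copyStructure⟩
  -- The choice is harmless, a symmetric monoidal structure admitting at most one copy structure.
  invFun M := ⟨M.1, M.2.nonempty_copyStructure.some⟩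
  left_inv _ := CounitalCopyCategory.ext_base rfl
  right_inv _ := rfl

/-- The two characterisations of copy categories in terms of `Copy` agree. -/
def equivIsEquivalentToCopy (C : Type u) [Category.{v} C] :
    {M : SymmetricMonoidalStructure C // M.ForgetIsEquivalence} ≃
      {M : SymmetricMonoidalStructure C //
        SymmetricMonoidalStructure.IsEquivalentToCopy.{u, v, u, v} M} :=
  Equiv.subtypeEquivRight fun _ => ⟨fun h => h.isEquivalentToCopy, fun h => h.forgetIsEquivalence⟩

/-! ### Uniqueness of products for a given restriction -/

namespace CartesianData

variable {C : Type u} [Category.{v} C] {D E : CartesianData C} {R : RestrictionStructure C}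

/-- Restriction products for the same restriction structure are isomorphic. -/
def isoOfPairing (hD : D.IsPairing R) (tD : D.IsRestrictionTerminal R) (hE : E.IsPairing R)
    (tE : E.IsRestrictionTerminal R) : D.Iso E where
  prodIso X Y :=
    { hom := E.pair (D.fst X Y) (D.snd X Y)
      inv := D.pair (E.fst X Y) (E.snd X Y)
      hom_inv_id := by
        rw [hD.comp_pair, hE.pair_fst, hE.pair_snd, hD.rst_fst, hD.rst_snd, Category.id_comp,
          Category.id_comp, hD.pair_fst_snd]
      inv_hom_id := by
        rw [hE.comp_pair, hD.pair_fst, hD.pair_snd, hE.rst_fst, hE.rst_snd, Category.id_comp,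
          Category.id_comp, hE.pair_fst_snd] }
  oneIso :=
    { hom := E.bang D.one
      inv := D.bang E.one
      hom_inv_id := by rw [tD.comp_bang, tE.bang_total, tD.bang_one, Category.id_comp]
      inv_hom_id := by rw [tE.comp_bang, tD.bang_total, tE.bang_one, Category.id_comp] }
  map_comp f g := by
    simp [hE.comp_pair, hD.map_eq, hE.map_eq, hD.pair_fst, hD.pair_snd, hE.pair_fst_assoc,
      hE.pair_snd_assoc, hD.rst_fst, hD.rst_snd]
    apply hE.hom_ext
    · rw [hE.pair_fst, hE.pair_fst, R.rst_rst_comp, Category.assoc, R.rst_idem_assoc,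
        R.rst_comp_rst_comp_self]
    · rw [hE.pair_snd, hE.pair_snd, R.rst_rst_comp, Category.assoc, R.rst_idem_assoc,
        R.rst_comp_rst_comp_self]
  diag_comp X := by
    simp [hE.comp_pair, hD.diag_eq, hE.diag_eq, hD.pair_fst, hD.pair_snd]
  comp_fst X Y := by rw [hE.pair_fst, hD.rst_snd, Category.id_comp]
  comp_snd X Y := by rw [hE.pair_snd, hD.rst_fst, Category.id_comp]
  bang_comp X := by rw [tE.comp_bang, tD.bang_total, Category.id_comp]

/-- Compatibility with the projections fixes the components on products; on `T` the condition for
`t_T = 1` fixes the map outright. -/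
theorem Iso.eq_of_isPairing (tD : D.IsRestrictionTerminal R) (hE : E.IsPairing R)
    (θ θ' : D.Iso E) : θ = θ' := by
  ext X Y
  · apply hE.hom_ext
    · rw [θ.comp_fst, θ'.comp_fst]
    · rw [θ.comp_snd, θ'.comp_snd]
  · have h := θ.bang_comp D.one
    have h' := θ'.bang_comp D.one
    rw [tD.bang_one, Category.id_comp] at h h'
    rw [h, h']

end CartesianData

/-! ### Comparison isomorphisms are symmetric monoidal -/

namespace CopyStructure

section

variable {C : Type u} [Category.{v} C] [MonoidalCategory C] [SymmetricCategory C]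
  (K : CopyStructure C)

theorem tensor_hom_ext {W X Y : C} {f g : W ⟶ X ⊗ Y} (h₁ : f ≫ K.fst X Y = g ≫ K.fst X Y)
    (h₂ : f ≫ K.snd X Y = g ≫ K.snd X Y) : f = g := by
  rw [← K.copy_tensorHom_eta f, h₁, h₂, copy_tensorHom_eta]

theorem associator_hom_fst (X Y Z : C) :
    (α_ X Y Z).hom ≫ K.fst X (Y ⊗ Z) = K.fst (X ⊗ Y) Z ≫ K.fst X Y := by
  rw [← K.whiskerLeft_fst X (K.fst Y Z) (K.fst_counit Y Z), ← associator_inv_fst, Category.assoc,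
    Iso.hom_inv_id_assoc]

theorem associator_hom_snd_fst (X Y Z : C) :
    (α_ X Y Z).hom ≫ K.snd X (Y ⊗ Z) ≫ K.fst Y Z = K.fst (X ⊗ Y) Z ≫ K.snd X Y := by
  rw [← snd_natural, ← associator_inv_fst, Category.assoc, Iso.hom_inv_id_assoc]

theorem associator_hom_snd_snd (X Y Z : C) :
    (α_ X Y Z).hom ≫ K.snd X (Y ⊗ Z) ≫ K.snd Y Z = K.snd (X ⊗ Y) Z := by
  rw [← associator_inv_snd, Iso.hom_inv_id_assoc]

theorem snd_unit (X : C) : K.snd (𝟙_ C) X = (λ_ X).hom := K.data_one_snd X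

theorem fst_unit (X : C) : K.fst X (𝟙_ C) = (ρ_ X).hom := K.data_fst_one X

end

variable {C : Type u} [Category.{v} C] [MonoidalCategory C] [SymmetricCategory C]
  {D : Type u'} [Category.{v'} D] [MonoidalCategory D] [SymmetricCategory D]
  (K : CopyStructure C) (L : CopyStructure D) (F : C ⥤ D)

/-- The comparison isomorphisms of a functor between copy categories, compatible with products of
arrows, projections and counits. -/
structure Comparison where
  δ : ∀ X Y : C, F.obj (X ⊗ Y) ≅ F.obj X ⊗ F.obj Y
  η : F.obj (𝟙_ C) ≅ 𝟙_ D
  natural : ∀ {X X' Y Y' : C} (f : X ⟶ X') (g : Y ⟶ Y'),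
    F.map (f ⊗ₘ g) ≫ (δ X' Y').hom = (δ X Y).hom ≫ (F.map f ⊗ₘ F.map g)
  comp_fst : ∀ X Y : C, (δ X Y).hom ≫ L.fst _ _ = F.map (K.fst X Y)
  comp_snd : ∀ X Y : C, (δ X Y).hom ≫ L.snd _ _ = F.map (K.snd X Y)
  map_counit : ∀ X : C, F.map (K.counit X) ≫ η.hom = L.counit (F.obj X)

namespace Comparison

variable {K L F} (θ : Comparison K L F)

theorem comp_fst_assoc (X Y : C) {Z : D} (k : F.obj X ⟶ Z) :
    (θ.δ X Y).hom ≫ L.fst _ _ ≫ k = F.map (K.fst X Y) ≫ k := by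
  rw [← Category.assoc, θ.comp_fst]

theorem comp_snd_assoc (X Y : C) {Z : D} (k : F.obj Y ⟶ Z) :
    (θ.δ X Y).hom ≫ L.snd _ _ ≫ k = F.map (K.snd X Y) ≫ k := by
  rw [← Category.assoc, θ.comp_snd]

/-- Counits are natural only for total maps, so this preservation has to be proved; it permits
projecting past a whiskered `δ` in the associativity law. -/
theorem δ_counit (X Y : C) :
    (θ.δ X Y).hom ≫ L.counit (F.obj X ⊗ F.obj Y) = L.counit (F.obj (X ⊗ Y)) := by
  rw [← L.fst_counit, θ.comp_fst_assoc, ← θ.map_counit, ← Category.assoc, ← F.map_comp,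
    K.fst_counit, θ.map_counit]

theorem η_counit : θ.η.hom ≫ L.counit (𝟙_ D) = L.counit (F.obj (𝟙_ C)) := by
  rw [← θ.map_counit, K.counit_unit, L.counit_unit, F.map_id, Category.id_comp, Category.comp_id]

/-- The oplax monoidal structure given by comparison isomorphisms. -/
@[reducible]
def oplaxMonoidal : F.OplaxMonoidal where
  η := θ.η.hom
  δ X Y := (θ.δ X Y).hom
  δ_natural_left f X' := by
    have := θ.natural f (𝟙 X')
    simpa using this.symm
  δ_natural_right X' f := by
    have := θ.natural (𝟙 X') f
    simpa using this.symm
  oplax_associativity X Y Z := by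
    -- Both sides are compared under the three projections, each of which `δ` carries to the image
    -- of a projection of `C`.
    refine L.tensor_hom_ext ?_ (L.tensor_hom_ext ?_ ?_)
    · simp only [Category.assoc]
      rw [associator_hom_fst, ← Category.assoc (_ ▷ _), fst_natural, Category.assoc, θ.comp_fst,
        θ.comp_fst_assoc, L.whiskerLeft_fst _ _ (θ.δ_counit Y Z), θ.comp_fst, ← F.map_comp,
        ← F.map_comp, associator_hom_fst]
    · simp only [Category.assoc]
      rw [associator_hom_snd_fst, ← Category.assoc (_ ▷ _), fst_natural, Category.assoc,
        θ.comp_snd, θ.comp_fst_assoc, ← Category.assoc (_ ◁ _), snd_natural, Category.assoc,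
        θ.comp_fst, θ.comp_snd_assoc, ← F.map_comp, ← F.map_comp, ← F.map_comp,
        associator_hom_snd_fst]
    · simp only [Category.assoc]
      rw [associator_hom_snd_snd, L.whiskerRight_snd _ (θ.δ_counit X Y), θ.comp_snd,
        ← Category.assoc (_ ◁ _), snd_natural, Category.assoc,
        θ.comp_snd, θ.comp_snd_assoc, ← F.map_comp, ← F.map_comp,
        associator_hom_snd_snd]
  oplax_left_unitality X := by
    rw [← cancel_mono (λ_ (F.obj X)).hom, Iso.inv_hom_id, Category.assoc, Category.assoc,
      ← L.snd_unit, L.whiskerRight_snd _ θ.η_counit, θ.comp_snd, K.snd_unit, ← F.map_comp,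
      Iso.inv_hom_id, F.map_id]
  oplax_right_unitality X := by
    rw [← cancel_mono (ρ_ (F.obj X)).hom, Iso.inv_hom_id, Category.assoc, Category.assoc,
      ← L.fst_unit, L.whiskerLeft_fst _ _ θ.η_counit, θ.comp_fst, K.fst_unit, ← F.map_comp,
      Iso.inv_hom_id, F.map_id]

theorem map_braiding (X Y : C) : F.map (β_ X Y).hom ≫ (θ.δ Y X).hom =
    (θ.δ X Y).hom ≫ (β_ (F.obj X) (F.obj Y)).hom := by
  refine L.tensor_hom_ext ?_ ?_
  · rw [Category.assoc, Category.assoc, θ.comp_fst, braiding_fst, θ.comp_snd, ← F.map_comp,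
      braiding_fst]
  · rw [Category.assoc, Category.assoc, θ.comp_snd, braiding_snd, θ.comp_fst, ← F.map_comp,
      braiding_snd]

theorem exists_braided : ∃ B : F.Braided,
    (∀ X Y : C, B.toMonoidal.toLaxMonoidal.μ X Y = (θ.δ X Y).inv) ∧
      B.toMonoidal.toLaxMonoidal.ε = θ.η.inv := by
  -- The comparisons point out of `F(X ⊗ Y)`, so they give an oplax structure; inverting them yields
  -- the strong one, with `μ` and `ε` the inverses.
  let := θ.oplaxMonoidal
  have : IsIso (Functor.OplaxMonoidal.η F) := inferInstanceAs (IsIso θ.η.hom)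
  have : ∀ X Y, IsIso (Functor.OplaxMonoidal.δ F X Y) := fun X Y =>
    inferInstanceAs (IsIso (θ.δ X Y).hom)
  let M : F.Monoidal := Functor.Monoidal.ofOplaxMonoidal F
  have hμ : ∀ X Y : C, M.toLaxMonoidal.μ X Y = (θ.δ X Y).inv := fun X Y =>
    IsIso.Iso.inv_hom (θ.δ X Y)
  have hε : M.toLaxMonoidal.ε = θ.η.inv := IsIso.Iso.inv_hom θ.η
  exact ⟨{ M with
    braided := fun X Y => by
      rw [hμ, hμ, Iso.inv_comp_eq, ← Category.assoc, Iso.eq_comp_inv]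
      exact θ.map_braiding X Y }, hμ, hε⟩

end Comparison

end CopyStructure

theorem RestrictionProductCategory.nonempty_unique_iso {C : Type u} [Category.{v} C]
    {S S' : RestrictionProductCategory C} (e : S.restriction = S'.restriction) :
    Nonempty (Unique (S.data.Iso S'.data)) := by
  have hp := S'.isPairing
  have ht := S'.isTerminal
  rw [← e] at hp ht
  exact ⟨⟨⟨CartesianData.isoOfPairing S.isPairing S.isTerminal hp ht⟩, fun θ =>
    θ.eq_of_isPairing S.isTerminal hp _⟩⟩

namespace CounitalCopyCategory

variable {C : Type u} [Category.{v} C] (K L : CounitalCopyCategory C)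

theorem idIsSymmetricMonoidal (θ : K.toCartesianData.Iso L.toCartesianData) :
    K.IdIsSymmetricMonoidal L θ :=
  @CopyStructure.Comparison.exists_braided C _ K.base.monoidal K.base.symmetric C _
    L.base.monoidal L.base.symmetric K.copyStructure L.copyStructure (𝟭 C)
    (@CopyStructure.Comparison.mk C _ K.base.monoidal K.base.symmetric C _
      L.base.monoidal L.base.symmetric K.copyStructure L.copyStructure (𝟭 C)
      θ.prodIso θ.oneIso θ.map_comp θ.comp_fst θ.comp_snd θ.bang_comp)

theorem exists_iso_of_dom_eq
    (h : ∀ {X Y : C} (f : X ⟶ Y), K.toCartesianData.dom f = L.toCartesianData.dom f) :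
    ∃ θ : K.toCartesianData.Iso L.toCartesianData,
      (∀ θ' : K.toCartesianData.Iso L.toCartesianData, θ' = θ) ∧ K.IdIsSymmetricMonoidal L θ := by
  have e : K.toRestrictionProductCategory.restriction =
      L.toRestrictionProductCategory.restriction := RestrictionStructure.ext_rst h
  obtain ⟨hu⟩ := RestrictionProductCategory.nonempty_unique_iso e
  exact ⟨hu.default, hu.uniq, K.idIsSymmetricMonoidal L _⟩

end CounitalCopyCategory

end PartialMaps

theorem mainTheorem6 (C : Type u) [Category.{v} C] :
    -- (i) – (vi) are equivalent structures: bijections compatible with all the data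
    (∃ (e₁ : RestrictionProductCategory C ≃ PCategoryWithOne C)
      (e₂ : RestrictionProductCategory C ≃ PartialCartesianCategory C)
      (e₃ : RestrictionProductCategory C ≃ CounitalCopyCategory C)
      (e₄ : CounitalCopyCategory C ≃
        {M : SymmetricMonoidalStructure C // M.ForgetIsEquivalence})
      (e₅ : {M : SymmetricMonoidalStructure C // M.ForgetIsEquivalence} ≃
        {M : SymmetricMonoidalStructure C //
          SymmetricMonoidalStructure.IsEquivalentToCopy.{u, v, u, v} M}),
      (∀ S, (e₁ S).data = S.data) ∧
      (∀ S, (e₂ S).toPairingData.toCartesianData = S.data) ∧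
      (∀ S, (e₃ S).toCartesianData = S.data) ∧
      (∀ K, (e₄ K).1 = K.base) ∧
      (∀ M, (e₅ M).1 = M.1) ∧
      -- the restriction structure determined by the other structures
      (∀ (S : RestrictionProductCategory C) {X Y : C} (f : X ⟶ Y),
        S.restriction.rst f = S.data.dom f) ∧
      -- all the structure is determined by the symmetric monoidal structure
      (∀ S S' : RestrictionProductCategory C, (e₃ S).base = (e₃ S').base → S = S')) ∧
    -- in (vi) the category `V` may live in any universes
    (∀ M : SymmetricMonoidalStructure C,
      SymmetricMonoidalStructure.IsEquivalentToCopy.{u, v, u', v'} M → M.ForgetIsEquivalence) ∧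
    -- the structure isomorphisms of the symmetric monoidal structure in terms of the products
    (∀ K : CounitalCopyCategory C,
      (∀ X Y Z : C, (K.base.monoidal.associator X Y Z).inv = K.toCartesianData.assoc X Y Z) ∧
      (∀ X Y : C, (K.base.symmetric.braiding X Y).hom = K.toCartesianData.swap X Y) ∧
      (∀ X : C, (K.base.monoidal.rightUnitor X).hom =
        K.toCartesianData.fst X K.toCartesianData.one) ∧
      (∀ X : C, (K.base.monoidal.leftUnitor X).hom =
        K.toCartesianData.snd K.toCartesianData.one X)) ∧
    -- all the structure is determined, up to a unique isomorphism, by the restriction structure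
    (∀ S S' : RestrictionProductCategory C, S.restriction = S'.restriction →
      Nonempty (Unique (S.data.Iso S'.data))) ∧
    (∀ K L : CounitalCopyCategory C,
      (∀ {X Y : C} (f : X ⟶ Y), K.toCartesianData.dom f = L.toCartesianData.dom f) →
        ∃ θ : K.toCartesianData.Iso L.toCartesianData,
          (∀ θ' : K.toCartesianData.Iso L.toCartesianData, θ' = θ) ∧
          K.IdIsSymmetricMonoidal L θ) := by
  refine ⟨⟨equivPCategoryWithOne C, equivPartialCartesianCategory C, equivCounitalCopyCategory C,
    equivForgetIsEquivalence C, equivIsEquivalentToCopy C, fun _ => rfl,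
    fun S => CartesianData.toPairingData_toCartesianData S.isPairing,
    fun S => S.toCartesianData_toCounitalCopyCategory, fun _ => rfl, fun _ => rfl,
    fun S _ _ f => S.isPairing.rst_eq_dom f, fun S S' e => ?_⟩,
    fun M h => h.forgetIsEquivalence, fun K => ⟨K.associator_inv_eq, K.braiding_hom_eq,
    K.rightUnitor_hom_eq, K.leftUnitor_hom_eq⟩,
    fun _ _ e => RestrictionProductCategory.nonempty_unique_iso e,
    fun K L h => K.exists_iso_of_dom_eq L h⟩
  -- Equal symmetric monoidal structures have equal copy structures by uniqueness, and the bijection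
  -- with copy categories is injective.
  exact (equivCounitalCopyCategory C).injective (CounitalCopyCategory.ext_base e)
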